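/- Let $M$ be a complete connected $n$-dimensional Riemannian manifold (smooth, without boundary), with Riemannian distance $d$, Riemannian volume $\mathrm{vol}$ and open balls $B(m,R)$; for a function $u$ on $M$ write $u_B=\frac1{\mathrm{vol}(B)}\int_B u\,d\mathrm{vol}$. Let $\sigma\ge 1$ and $\beta\ge 1$ be real numbers. Assume: (i) (local volume doubling) for every $r>0$ there is a constant $C_r$ such that $\mathrm{vol}\,B(x,2r)\le C_r\,\mathrm{vol}\,B(x,r)$ for all $x\in M$; (ii) (local Poincaré inequality with exponent $\sigma$) for every $R>0$ there is a constant $K_R$ such that for all $u\in C^1(M)$ and all $m\in M$ $$\int_{B(m,R)}|u-u_{B(m,R)}|^\sigma\,d\mathrm{vol}\le K_R\int_{B(m,3R)}|\nabla u|^\sigma\,d\mathrm{vol}.$$ Let $\varepsilon>0$ and let $X\subset M$ be an $\varepsilon$-discretization of $M$, that is, a maximal (with respect to inclusion) subset any two distinct points of which are at distance at least $\varepsilon$. Make $X$ a graph by joining distinct points $x,y$ (written $x\sim y$) when $d(x,y)<2\varepsilon$; let $\rho$ be its combinatorial distance, $B_\rho(x_0,R)=\{x\in X:\rho(x_0,x)<R\}$,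 and $\mu(x)=\mathrm{vol}\,B(x,\varepsilon)$. For $f:X\to\mathbb R$ put $\delta f(x)=\bigl(\sum_{y\sim x}|f(y)-f(x)|^2\bigr)^{1/2}$ and $f_R=\frac{1}{\mu(B_\rho(x_0,R))}\sum_{x\in B_\rho(x_0,R)}\mu(x)f(x)$. Then the following are equivalent. (a) ($M$ satisfies the uniform $(\sigma,\beta,\sigma)$-Poincaré inequality.) There is a constant $C>0$ such that for every $r_0>0$ there is a constant $K>0$ such that for all $u\in C^1(M)$, all $R\ge r_0$ and all $m\in M$ $$\int_{B(m,R)}|u-u_{B(m,R)}|^\sigma\,d\mathrm{vol}\le K R^\beta\int_{B(m,CR)}|\nabla u|^\sigma\,d\mathrm{vol}.$$ (b) ($X$ satisfies the discrete uniform $(\sigma,\beta,\sigma)$-Poincaré inequality.) There are constants $r_1>0$, $C>0$ and $C'\ge1$ such that for all $f:X\to\mathbb R$, all $R\ge r_1$ and all $x_0\in X$ $$\sum_{x\in B_\rho(x_0,R)}|f(x)-f_R|^\sigma\mu(x)\le C R^\beta\sum_{x\in B_\rho(x_0,C'R)}(\delta f(x))^\sigma\mu(x).$$ -/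

import Mathlib

open Set MeasureTheory Manifold Bundle
open scoped ENNReal NNReal ContDiff

noncomputable section

/-! ### Riemannian volume and length of the gradient -/

section Riemannian

variable {n : ℕ} {M : Type*} [TopologicalSpace M] [ChartedSpace (EuclideanSpace ℝ (Fin n)) M]
  [RiemannianBundle (fun x : M ↦ TangentSpace (𝓡 n) x)]

/-- The Gram matrix `g_ij = g(∂ᵢ, ∂ⱼ)` of the Riemannian metric in a chart `φ`, at the point `y` of
the target of `φ`; the coordinate vector field `∂ᵢ` is the image of the `i`-th vector of the
standard basis under the differential of `φ⁻¹`. -/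
def chartGram (φ : OpenPartialHomeomorph M (EuclideanSpace ℝ (Fin n)))
    (y : EuclideanSpace ℝ (Fin n)) : Matrix (Fin n) (Fin n) ℝ :=
  Matrix.of fun i j ↦
    inner ℝ
      (mfderiv (𝓡 n) (𝓡 n) φ.symm y (EuclideanSpace.single i (1 : ℝ) : EuclideanSpace ℝ (Fin n)) :
        TangentSpace (𝓡 n) (φ.symm y))
      (mfderiv (𝓡 n) (𝓡 n) φ.symm y (EuclideanSpace.single j (1 : ℝ) : EuclideanSpace ℝ (Fin n)) :
        TangentSpace (𝓡 n) (φ.symm y))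

/-- The measure `√(det g_ij) dy₁ … dyₙ` of a chart, transported to the manifold and extended by
zero outside the domain of the chart. -/
def chartVolume [MeasurableSpace M] (φ : OpenPartialHomeomorph M (EuclideanSpace ℝ (Fin n))) :
    Measure M :=
  ((volume.restrict φ.target).withDensity
    fun y ↦ ENNReal.ofReal (Real.sqrt (chartGram φ y).det)).map φ.symm

variable (n M) in
/-- The canonical (Riemannian) measure of a Riemannian manifold: the smallest measure that is at
least `√(det g_ij) dy₁ … dyₙ` in each chart of the given atlas. By the change of variables formula
the measures of two charts agree where both charts are defined, so this is the measure that equals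
`√(det g_ij) dy₁ … dyₙ` in each chart. -/
def riemannianVolume [MeasurableSpace M] : Measure M :=
  ⨆ x : M, chartVolume (chartAt (EuclideanSpace ℝ (Fin n)) x)

variable (n) in
/-- The length `|∇u|` of the gradient of `u` at `x`, that is, the norm of the differential of `u` at
`x` with respect to the Riemannian norm of the tangent space. -/
def gradLength (u : M → ℝ) (x : M) : ℝ≥0∞ :=
  ‖mvfderiv (𝓡 n) u x‖ₑ

end Riemannian

section ManifoldInequalities

/-- The local doubling condition `(DV)_loc` for a metric measure space. -/
def LocalDoubling {Y : Type*} [PseudoMetricSpace Y] [MeasurableSpace Y] (μ : Measure Y) : Prop :=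
  ∀ r : ℝ, 0 < r → ∃ C : ℝ≥0, ∀ x : Y, μ (Metric.ball x (2 * r)) ≤ C * μ (Metric.ball x r)

variable (n : ℕ) (M : Type*) [MetricSpace M] [MeasurableSpace M]
  [ChartedSpace (EuclideanSpace ℝ (Fin n)) M]
  [RiemannianBundle (fun x : M ↦ TangentSpace (𝓡 n) x)]

/-- The local Poincaré inequality with exponent `σ`: for every radius `R` there is a constant, not
depending on the function and on the centre, for which the inequality on balls of radius `R` holds.
Here `⨍ y in B, u y ∂vol` is the mean `u_B` of `u` over `B`. -/
def LocalPoincare (σ : ℝ) : Prop :=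
  ∀ R : ℝ, 0 < R → ∃ K : ℝ≥0, ∀ u : M → ℝ, ContMDiff (𝓡 n) 𝓘(ℝ, ℝ) 1 u → ∀ m : M,
    ∫⁻ x in Metric.ball m R, ‖u x - ⨍ y in Metric.ball m R, u y ∂(riemannianVolume n M)‖ₑ ^ σ
        ∂(riemannianVolume n M)
      ≤ K * ∫⁻ x in Metric.ball m (3 * R), gradLength n u x ^ σ ∂(riemannianVolume n M)

/-- The uniform `(σ, β, σ)`-Poincaré inequality of a Riemannian manifold. -/
def UniformPoincare (σ β : ℝ) : Prop :=
  ∃ C : ℝ, 0 < C ∧ ∀ r₀ : ℝ, 0 < r₀ → ∃ K : ℝ, 0 < K ∧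
    ∀ u : M → ℝ, ContMDiff (𝓡 n) 𝓘(ℝ, ℝ) 1 u → ∀ R : ℝ, r₀ ≤ R → ∀ m : M,
      ∫⁻ x in Metric.ball m R, ‖u x - ⨍ y in Metric.ball m R, u y ∂(riemannianVolume n M)‖ₑ ^ σ
          ∂(riemannianVolume n M)
        ≤ ENNReal.ofReal (K * R ^ β) *
          ∫⁻ x in Metric.ball m (C * R), gradLength n u x ^ σ ∂(riemannianVolume n M)

end ManifoldInequalities

/-! ### Graphs with weighted vertices -/

section Graphs

variable {V : Type*} (G : SimpleGraph V) (μ : V → ℝ≥0∞)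

/-- The open ball of radius `R` for the combinatorial distance of a graph. -/
def graphBall (x₀ : V) (R : ℝ) : Set V :=
  {x | (G.edist x₀ x : ℝ≥0∞) < ENNReal.ofReal R}

/-- The length `δf(x) = (∑_{y ∼ x} |f(y) - f(x)|²)^{1/2}` of the discrete gradient. -/
def discreteGradLength (f : V → ℝ) (x : V) : ℝ≥0∞ :=
  (∑' y : G.neighborSet x, ‖f y - f x‖ₑ ^ 2) ^ (1 / 2 : ℝ)

/-- The mean of `f` over the set `A` with respect to the weights `μ`. -/
def weightedMean (f : V → ℝ) (A : Set V) : ℝ :=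
  (∑' x : A, (μ x).toReal)⁻¹ * ∑' x : A, (μ x).toReal * f x

/-- The discrete uniform `(σ, β, σ)`-Poincaré inequality of a graph with weighted vertices. -/
def DiscretePoincare (σ β : ℝ) : Prop :=
  ∃ r₁ : ℝ, 0 < r₁ ∧ ∃ C : ℝ, 0 < C ∧ ∃ C' : ℝ, 1 ≤ C' ∧
    ∀ f : V → ℝ, ∀ R : ℝ, r₁ ≤ R → ∀ x₀ : V,
      ∑' x : graphBall G x₀ R, ‖f x - weightedMean μ f (graphBall G x₀ R)‖ₑ ^ σ * μ x
        ≤ ENNReal.ofReal (C * R ^ β) *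
          ∑' x : graphBall G x₀ (C' * R), discreteGradLength G f x ^ σ * μ x

end Graphs

/-! ### Discretizations -/

section Discretization

variable {Y : Type*} [PseudoMetricSpace Y]

/-- An `ε`-discretization: a subset any two distinct points of which have distance at least `ε`,
and which is maximal, with respect to inclusion, among such subsets. -/
def IsDiscretization (ε : ℝ) (X : Set Y) : Prop :=
  Maximal (fun S : Set Y ↦ S.Pairwise fun x y ↦ ε ≤ dist x y) X

/-- The graph structure of an `ε`-discretization: the neighbours of `x` are the points of the
discretization in the open ball `B(x, 2ε)` other than `x`. -/
def discretizationGraph (ε : ℝ) (X : Set Y) : SimpleGraph X where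
  Adj x y := x ≠ y ∧ dist (x : Y) (y : Y) < 2 * ε
  symm := ⟨fun _ _ h ↦ ⟨h.1.symm, dist_comm (_ : Y) _ ▸ h.2⟩⟩
  loopless := ⟨fun _ h ↦ h.1 rfl⟩

/-- The measure of a point `x` of an `ε`-discretization: the volume of `B(x, ε)`. -/
def discretizationWeight [MeasurableSpace Y] (vol : Measure Y) (ε : ℝ) (X : Set Y) (x : X) :
    ℝ≥0∞ :=
  vol (Metric.ball (x : Y) ε)

end Discretization

end

open scoped Topology

set_option linter.unusedSectionVars false

/-! ### Lengths of paths and comparison with charts -/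

section

variable {n : ℕ} {M : Type*} [MetricSpace M]
    [ChartedSpace (EuclideanSpace ℝ (Fin n)) M] [IsManifold (𝓡 n) ∞ M]
    [RiemannianBundle (fun x : M ↦ TangentSpace (𝓡 n) x)]

/-! The two inequalities are compared by moving functions between `M` and `X`. A function `u` on `M`
is sent to its means `f x` over the balls `B(x, ε)`. A function `f` on `X` is sent to `v = ∑ f(y)
φ_y / ∑ φ_y`, where `φ_y` are `C¹` bumps living at scale `ε`. Both transfers have errors and
gradients controlled locally, and local errors can be added over `X` because balls of a fixed radius
centred at points of `X` have bounded overlap.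

Local doubling supplies the counting: a packing argument bounds the number of points of `X` in a
ball of given radius (`LocalDoubling.exists_card_le`), hence bounded overlap, bounded degree and,
with completeness, properness of `M`. Connectedness of Riemannian balls and almost minimizing paths
make `X` roughly isometric to `M`: `d ≤ 2ε ρ` always, and `ρ ≤ a D + b` when `d < D`
(`IsDiscretization.exists_mem_graphBall`).

From (b) to (a): local Poincaré at scale `3ε` bounds `(δf)^σ μ` at `x` by the energy of `u` in `B(x,
9ε)`, and at scale `ε` it bounds `u - f x` on `B(x, ε)`. Summing with the discrete inequality treats
all `R ≥ ε`; radii between `r₀` and `ε` span finitely many dyadic scales, where local Poincaré is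
enough.

From (a) to (b): `v - f x` and `|∇v|` on `B(x, ε)` are bounded by the oscillation of `f` near `x`,
which short walks bound by nearby values of `δf`. The inequality for `v` on a ball containing all
relevant `B(x, ε)` then yields the one for `f`. In both directions means may be replaced by any
constant at the cost of a factor `2^σ`, and error terms without `R^β` are absorbed since `R` is
bounded below.

The Riemannian input is a family of bumps with one Lipschitz constant for all centres. With no
curvature bound, it comes from smoothing the distance function: near each point the chart distorts
lengths by a factor at most 2 relative to the frozen metric there, so mollification keeps the
Lipschitz constant up to a universal factor. It must also be shown that the volume, a supremum of
chart measures, is locally finite and charges open sets. -/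

theorem edist_le_pathELength [IsRiemannianManifold (𝓡 n) M] {γ : ℝ → M}
    (hγ : ContMDiff 𝓘(ℝ, ℝ) (𝓡 n) 1 γ) {s t : ℝ} (hst : s ≤ t) :
    edist (γ s) (γ t) ≤ pathELength (𝓡 n) γ s t := by
  rw [IsRiemannianManifold.out (I := 𝓡 n)]
  exact riemannianEDist_le_pathELength hγ.contMDiffOn rfl rfl hst

theorem exists_path_of_edist_lt [IsRiemannianManifold (𝓡 n) M] {p q : M} {r : ℝ≥0∞}
    (h : edist p q < r) :
    ∃ γ : ℝ → M, γ 0 = p ∧ γ 1 = q ∧ ContMDiff 𝓘(ℝ, ℝ) (𝓡 n) 1 γ ∧ pathELength (𝓡 n) γ 0 1 < r := by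
  rw [IsRiemannianManifold.out (I := 𝓡 n)] at h
  obtain ⟨γ, h0, h1, h2, h3, -⟩ := exists_lt_locally_constant_of_riemannianEDist_lt h zero_lt_one
  exact ⟨γ, h0, h1, h2, h3⟩

variable (n) in
/-- The Riemannian norm at `x` of a tangent vector given in the model space. -/
noncomputable def tanNorm (x : M) (w : EuclideanSpace ℝ (Fin n)) : ℝ :=
  ‖(show TangentSpace (𝓡 n) x from w)‖

instance isContinuousRiemannianBundle_tangentSpace
    [IsContMDiffRiemannianBundle (𝓡 n) ∞ (EuclideanSpace ℝ (Fin n))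
      (fun x : M ↦ TangentSpace (𝓡 n) x)] : IsContinuousRiemannianBundle (EuclideanSpace ℝ (Fin n))
      (fun x : M ↦ TangentSpace (𝓡 n) x) := by
  obtain ⟨g, hg, h⟩ := IsContMDiffRiemannianBundle.exists_contMDiff (IB := 𝓡 n) (n := ∞)
    (F := EuclideanSpace ℝ (Fin n)) (E := fun x : M ↦ TangentSpace (𝓡 n) x)
  exact ⟨g, hg.continuous, h⟩

local notation "𝔼" => EuclideanSpace ℝ (Fin n)

variable [IsContinuousRiemannianBundle (EuclideanSpace ℝ (Fin n))
  (fun x : M ↦ TangentSpace (𝓡 n) x)]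

/-- At its own base point the tangent trivialization is the identity on the model space. This
justifies measuring model vectors with the metric frozen at `x`. -/
theorem symmL_self (x : M) (w : 𝔼) :
    (trivializationAt 𝔼 (fun x : M ↦ TangentSpace (𝓡 n) x) x).symmL ℝ x w =
      (show TangentSpace (𝓡 n) x from w) := by
  have h3 := TangentBundle.symmL_trivializationAt (I := 𝓡 n)
    (mem_chart_source (EuclideanSpace ℝ (Fin n)) x)
  have := mfderivWithin_range_extChartAt_symm (I := 𝓡 n) (x := x)
  exact DFunLike.congr_fun (h3.trans this) w

theorem clmAt_self (x : M) (w : TangentSpace (𝓡 n) x) :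
    (trivializationAt 𝔼 (fun x : M ↦ TangentSpace (𝓡 n) x) x).continuousLinearMapAt ℝ x w =
      (show 𝔼 from w) := by
  have h3 := TangentBundle.continuousLinearMapAt_trivializationAt (I := 𝓡 n)
    (mem_chart_source (EuclideanSpace ℝ (Fin n)) x)
  have := mfderiv_extChartAt_self (I := 𝓡 n) (x := x)
  exact DFunLike.congr_fun (h3.trans this) w

/-- Continuity of the metric: the comparison of nearby tangent spaces with the one at `x` has norm
tending to 1, and 2 is a convenient constant above 1. The next lemma is the same for the inverse
chart. -/
theorem eventually_tanNorm_mvfderiv_le (x : M) : ∀ᶠ y in 𝓝 x, ∀ v : TangentSpace (𝓡 n) y,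
    tanNorm n x (mvfderiv (𝓡 n) (extChartAt (𝓡 n) x) y v) ≤ 2 * ‖v‖ := by
  have := eventually_norm_symmL_trivializationAt_self_comp_lt 𝔼
    (fun x : M ↦ TangentSpace (𝓡 n) x) x one_lt_two
  filter_upwards [this, chart_source_mem_nhds 𝔼 x] with y hy h'y v
  have h2 := TangentBundle.continuousLinearMapAt_trivializationAt (I := 𝓡 n) h'y
  refine le_trans (le_of_eq ?_)
    ((ContinuousLinearMap.le_opNorm _ v).trans (mul_le_mul_of_nonneg_right hy.le (norm_nonneg v)))
  rw [ContinuousLinearMap.comp_apply, symmL_self]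
  exact congrArg (tanNorm n x) (DFunLike.congr_fun h2 v).symm

theorem eventually_norm_mfderiv_symm_le (x : M) : ∀ᶠ a in 𝓝 (extChartAt (𝓡 n) x x), ∀ w : 𝔼,
    ‖(mfderiv (𝓡 n) (𝓡 n) (extChartAt (𝓡 n) x).symm a w :
      TangentSpace (𝓡 n) ((extChartAt (𝓡 n) x).symm a))‖ ≤ 2 * tanNorm n x w := by
  have := eventually_norm_symmL_trivializationAt_comp_self_lt 𝔼
    (fun x : M ↦ TangentSpace (𝓡 n) x) x one_lt_two
  have h1 : ContinuousAt (extChartAt (𝓡 n) x).symm (extChartAt (𝓡 n) x x) :=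
    continuousAt_extChartAt_symm x
  have h0 : (extChartAt (𝓡 n) x).symm (extChartAt (𝓡 n) x x) = x := extChartAt_to_inv x
  have h2 : (extChartAt (𝓡 n) x).target ∈ 𝓝 (extChartAt (𝓡 n) x x) := extChartAt_target_mem_nhds x
  rw [ContinuousAt, h0] at h1
  filter_upwards [h1.eventually this, h2] with a ha h'a w
  have h'y : (extChartAt (𝓡 n) x).symm a ∈ (chartAt 𝔼 x).source := by
    simpa [extChartAt_source] using (extChartAt (𝓡 n) x).map_target h'a
  have h3 := TangentBundle.symmL_trivializationAt (I := 𝓡 n) h'y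
  rw [(extChartAt (𝓡 n) x).right_inv h'a] at h3
  simp only [modelWithCornersSelf_coe, range_id, mfderivWithin_univ] at h3
  refine le_trans (le_of_eq ?_)
    ((ContinuousLinearMap.le_opNorm _ (show TangentSpace (𝓡 n) x from w)).trans
      (mul_le_mul_of_nonneg_right ha.le (norm_nonneg _)))
  rw [ContinuousLinearMap.comp_apply, clmAt_self]
  exact congrArg (fun z : TangentSpace (𝓡 n) ((extChartAt (𝓡 n) x).symm a) ↦ ‖z‖)
    (DFunLike.congr_fun h3 w).symm

theorem enorm_sub_le_mul_pathELength {u : M → ℝ} {s : Set M} (hs : IsOpen s)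
    (hu : ContMDiffOn (𝓡 n) 𝓘(ℝ, ℝ) 1 u s) {K : ℝ≥0}
    (hK : ∀ y ∈ s, ∀ v : TangentSpace (𝓡 n) y, ‖mvfderiv (𝓡 n) u y v‖ ≤ K * ‖v‖)
    {γ : ℝ → M} (hγ : ContMDiff 𝓘(ℝ, ℝ) (𝓡 n) 1 γ) (hγs : ∀ t ∈ Icc (0 : ℝ) 1, γ t ∈ s) :
    ‖u (γ 1) - u (γ 0)‖ₑ ≤ K * pathELength (𝓡 n) γ 0 1 := by
  have hC : ContMDiffOn 𝓘(ℝ, ℝ) 𝓘(ℝ, ℝ) 1 (u ∘ γ) (Icc 0 1) :=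
    hu.comp hγ.contMDiffOn hγs
  calc ‖(u ∘ γ) 1 - (u ∘ γ) 0‖ₑ
      ≤ ∫⁻ t in Icc (0 : ℝ) 1, ‖derivWithin (u ∘ γ) (Icc 0 1) t‖ₑ :=
        enorm_sub_le_lintegral_derivWithin_Icc_of_contDiffOn_Icc
          (contMDiffOn_iff_contDiffOn.1 hC) zero_le_one
    _ ≤ ∫⁻ t in Icc (0 : ℝ) 1, K * ‖mfderivWithin 𝓘(ℝ, ℝ) (𝓡 n) γ (Icc 0 1) t 1‖ₑ := by
        apply setLIntegral_mono' measurableSet_Icc (fun t ht ↦ ?_)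
        have h1 : mvfderivWithin 𝓘(ℝ, ℝ) (u ∘ γ) (Icc 0 1) t =
            (mvfderiv (𝓡 n) u (γ t)).comp (mfderivWithin 𝓘(ℝ, ℝ) (𝓡 n) γ (Icc 0 1) t) := by
          apply mvfderiv_comp_mfderivWithin
          · exact (hu.contMDiffAt (hs.mem_nhds (hγs t ht))).mdifferentiableAt one_ne_zero
          · exact (hγ.mdifferentiable one_ne_zero).mdifferentiableOn _ ht
          · rw [uniqueMDiffWithinAt_iff_uniqueDiffWithinAt]
            exact uniqueDiffOn_Icc zero_lt_one _ ht
        have h2 : derivWithin (u ∘ γ) (Icc 0 1) t =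
            mvfderiv (𝓡 n) u (γ t) (mfderivWithin 𝓘(ℝ, ℝ) (𝓡 n) γ (Icc 0 1) t 1) := by
          refine Eq.trans ?_ (DFunLike.congr_fun h1 1)
          rw [← fderivWithin_derivWithin, ← mfderivWithin_eq_fderivWithin]
          rfl
        rw [h2]
        have := hK _ (hγs t ht) (mfderivWithin 𝓘(ℝ, ℝ) (𝓡 n) γ (Icc 0 1) t 1)
        simp only [enorm, nnnorm]
        exact_mod_cast this
    _ = K * pathELength (𝓡 n) γ 0 1 := by
        rw [lintegral_const_mul' _ _ ENNReal.coe_ne_top, pathELength_eq_lintegral_mfderivWithin_Icc]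

/-- A mean value inequality without convexity: two points of `B(x, r)` are joined by a path of
length less than `2r`, and such a path cannot leave `B(x, 3r)`. -/
theorem abs_sub_le_of_mvfderiv_le [IsRiemannianManifold (𝓡 n) M] {u : M → ℝ} {x : M} {r : ℝ}
    (hu : ContMDiffOn (𝓡 n) 𝓘(ℝ, ℝ) 1 u (Metric.ball x (3 * r))) {K : ℝ≥0}
    (hK : ∀ y ∈ Metric.ball x (3 * r), ∀ v : TangentSpace (𝓡 n) y,
      ‖mvfderiv (𝓡 n) u y v‖ ≤ K * ‖v‖)
    {p q : M} (hp : p ∈ Metric.ball x r) (hq : q ∈ Metric.ball x r) :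
    |u p - u q| ≤ K * dist p q := by
  rw [Metric.mem_ball] at hp hq
  have hpq : dist p q < 2 * r := by linarith [dist_triangle_right p q x]
  have key : ∀ D : ℝ, dist p q < D → D < 2 * r → |u p - u q| ≤ K * D := by
    intro D hD hDr
    have hD0 : 0 < D := dist_nonneg.trans_lt hD
    have : edist p q < ENNReal.ofReal D := by
      rw [edist_dist]; exact (ENNReal.ofReal_lt_ofReal_iff hD0).2 hD
    obtain ⟨γ, rfl, rfl, hγ, hlen⟩ := exists_path_of_edist_lt (n := n) this
    have h := enorm_sub_le_mul_pathELength Metric.isOpen_ball hu hK hγ (fun t ht ↦ by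
      have h1 : edist (γ 0) (γ t) < ENNReal.ofReal D :=
        ((edist_le_pathELength hγ ht.1).trans (pathELength_mono le_rfl ht.2)).trans_lt hlen
      rw [edist_dist, ENNReal.ofReal_lt_ofReal_iff hD0] at h1
      rw [Metric.mem_ball]
      linarith [dist_triangle_left (γ t) x (γ 0)])
    have h2 : ‖u (γ 1) - u (γ 0)‖ₑ ≤ ENNReal.ofReal (K * D) := by
      rw [ENNReal.ofReal_mul (NNReal.coe_nonneg K), ENNReal.ofReal_coe_nnreal]
      exact h.trans (by gcongr)
    rw [← ofReal_norm, ENNReal.ofReal_le_ofReal_iff (by positivity)] at h2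
    rwa [abs_sub_comm]
  obtain ⟨D, h1, h2⟩ := exists_between hpq
  -- The bound holds for every `D` slightly above `dist p q`; let `D` decrease to it.
  have ht : Filter.Tendsto (fun D : ℝ ↦ (K : ℝ) * D) (𝓝[>] (dist p q)) (𝓝 (K * dist p q)) :=
    ((continuous_const.mul continuous_id).tendsto _).mono_left nhdsWithin_le_nhds
  refine ge_of_tendsto ht ?_
  filter_upwards [Ioo_mem_nhdsGT hpq] with D hD using key D hD.1 hD.2

/-! ### The frozen norm on the model space -/

section tanNorm

variable (x : M)

theorem tanNorm_nonneg (w : 𝔼) : 0 ≤ tanNorm n x w := norm_nonneg (show TangentSpace (𝓡 n) x from w)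

theorem tanNorm_smul (c : ℝ) (w : 𝔼) : tanNorm n x (c • w) = |c| * tanNorm n x w :=
  norm_smul c (show TangentSpace (𝓡 n) x from w)

theorem tanNorm_sub_comm (v w : 𝔼) : tanNorm n x (v - w) = tanNorm n x (w - v) :=
  norm_sub_rev (show TangentSpace (𝓡 n) x from v) (show TangentSpace (𝓡 n) x from w)

theorem exists_tanNorm_le : ∃ C : ℝ≥0, ∀ w : 𝔼, tanNorm n x w ≤ C * ‖w‖ := by
  refine ⟨‖(trivializationAt 𝔼 (fun x : M ↦ TangentSpace (𝓡 n) x) x).symmL ℝ x‖₊, fun w ↦ ?_⟩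
  have := ContinuousLinearMap.le_opNorm
    ((trivializationAt 𝔼 (fun x : M ↦ TangentSpace (𝓡 n) x) x).symmL ℝ x) w
  rwa [symmL_self] at this

theorem exists_norm_le_tanNorm : ∃ C : ℝ≥0, ∀ w : 𝔼, ‖w‖ ≤ C * tanNorm n x w := by
  refine ⟨‖(trivializationAt 𝔼 (fun x : M ↦ TangentSpace (𝓡 n) x) x).continuousLinearMapAt ℝ x‖₊,
    fun w ↦ ?_⟩
  have := ContinuousLinearMap.le_opNorm
    ((trivializationAt 𝔼 (fun x : M ↦ TangentSpace (𝓡 n) x) x).continuousLinearMapAt ℝ x)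
    (show TangentSpace (𝓡 n) x from w)
  rwa [clmAt_self] at this

/-- The functional is the frozen inner product with `w`. It reduces estimates of chart differences
to the scalar mean value inequality. -/
theorem exists_dual_tanNorm (w : 𝔼) :
    ∃ ℓ : 𝔼 →L[ℝ] ℝ, ℓ w = tanNorm n x w ^ 2 ∧ ∀ v, |ℓ v| ≤ tanNorm n x w * tanNorm n x v := by
  refine ⟨(innerSL ℝ (show TangentSpace (𝓡 n) x from w)).comp
    ((trivializationAt 𝔼 (fun x : M ↦ TangentSpace (𝓡 n) x) x).symmL ℝ x), ?_, fun v ↦ ?_⟩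
  · rw [ContinuousLinearMap.comp_apply, symmL_self]
    exact real_inner_self_eq_norm_sq (show TangentSpace (𝓡 n) x from w)
  · rw [ContinuousLinearMap.comp_apply, symmL_self]
    exact abs_real_inner_le_norm (show TangentSpace (𝓡 n) x from w)
      (show TangentSpace (𝓡 n) x from v)

end tanNorm

variable [IsRiemannianManifold (𝓡 n) M]

/-- Apply the scalar mean value inequality to `ℓ ∘ chart`, with `ℓ` dual to the difference `w` of
the images: the result is `|w|² ≤ 2 |w| d(p, q)`. -/
theorem exists_tanNorm_extChartAt_sub_le (x : M) : ∃ r > 0,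
    Metric.ball x r ⊆ (chartAt 𝔼 x).source ∧ ∀ p ∈ Metric.ball x r, ∀ q ∈ Metric.ball x r,
      tanNorm n x (extChartAt (𝓡 n) x p - extChartAt (𝓡 n) x q) ≤ 2 * dist p q := by
  obtain ⟨ρ, hρ, hball⟩ := Metric.mem_nhds_iff.1
    (Filter.inter_mem (eventually_tanNorm_mvfderiv_le (n := n) x) (chart_source_mem_nhds 𝔼 x))
  refine ⟨ρ / 3, by positivity, (Metric.ball_subset_ball (by linarith)).trans
    (hball.trans inter_subset_right), fun p hp q hq ↦ ?_⟩
  set w := extChartAt (𝓡 n) x p - extChartAt (𝓡 n) x q with hw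
  obtain ⟨ℓ, hℓ, hℓ'⟩ := exists_dual_tanNorm x w
  have hw0 : 0 ≤ 2 * tanNorm n x w := mul_nonneg zero_le_two (tanNorm_nonneg x w)
  have h3 : 3 * (ρ / 3) = ρ := by ring
  have hsm : ContMDiffOn (𝓡 n) 𝓘(ℝ, ℝ) 1 (fun y ↦ ℓ (extChartAt (𝓡 n) x y))
      (Metric.ball x (3 * (ρ / 3))) := by
    rw [h3]
    exact ℓ.contMDiff.comp_contMDiffOn
      (contMDiffOn_extChartAt.mono (hball.trans inter_subset_right))
  have key := abs_sub_le_of_mvfderiv_le hsm (K := (2 * tanNorm n x w).toNNReal)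
    (fun y hy v ↦ by
      rw [h3] at hy
      have h1 : MDifferentiableAt (𝓡 n) 𝓘(ℝ, 𝔼) (extChartAt (𝓡 n) x) y :=
        mdifferentiableAt_extChartAt (hball hy).2
      have h2 : mvfderiv (𝓡 n) (fun y ↦ ℓ (extChartAt (𝓡 n) x y)) y v =
          ℓ (mvfderiv (𝓡 n) (extChartAt (𝓡 n) x) y v) := by
        have := mfderiv_comp y (ℓ.mdifferentiableAt (x := extChartAt (𝓡 n) x y)) h1
        rw [ContinuousLinearMap.mfderiv_eq] at this
        exact DFunLike.congr_fun this v
      rw [h2, Real.norm_eq_abs]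
      refine (hℓ' _).trans ?_
      have := (hball hy).1 v
      rw [Real.coe_toNNReal _ hw0]
      nlinarith [tanNorm_nonneg (n := n) x w]) hp hq
  rw [Real.coe_toNNReal _ hw0] at key
  rw [← map_sub, ← hw, hℓ, abs_of_nonneg (by positivity)] at key
  rcases (tanNorm_nonneg (n := n) x w).eq_or_lt with h | h
  · rw [← h]; positivity
  · nlinarith

/-- The coordinate segment from `a` to `b`, lifted to the manifold, has length at most `2 |a - b|`
in the frozen norm. -/
theorem exists_dist_extChartAt_symm_le (x : M) : ∃ r > 0,
    Metric.ball (extChartAt (𝓡 n) x x) r ⊆ (extChartAt (𝓡 n) x).target ∧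
    ∀ a ∈ Metric.ball (extChartAt (𝓡 n) x x) r, ∀ b ∈ Metric.ball (extChartAt (𝓡 n) x x) r,
      dist ((extChartAt (𝓡 n) x).symm a) ((extChartAt (𝓡 n) x).symm b) ≤
        2 * tanNorm n x (a - b) := by
  obtain ⟨r, hr, hball⟩ := Metric.mem_nhds_iff.1
    (Filter.inter_mem (eventually_norm_mfderiv_symm_le (n := n) x)
      (extChartAt_target_mem_nhds (I := 𝓡 n) x))
  refine ⟨r, hr, hball.trans inter_subset_right, fun a ha b hb ↦ ?_⟩
  let η := ContinuousAffineMap.lineMap (R := ℝ) a b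
  have hη : Icc 0 1 ⊆ ⇑η ⁻¹' Metric.ball (extChartAt (𝓡 n) x x) r := by
    simp only [← image_subset_iff, ContinuousAffineMap.coe_lineMap_eq,
      ← segment_eq_image_lineMap, η]
    exact (convex_ball _ _).segment_subset ha hb
  have η_smooth : ContMDiffOn 𝓘(ℝ, ℝ) 𝓘(ℝ, 𝔼) 1 η (Icc 0 1) := by
    apply ContMDiff.contMDiffOn
    rw [contMDiff_iff_contDiff]
    exact ContinuousAffineMap.contDiff _
  set γ := (extChartAt (𝓡 n) x).symm ∘ η
  have hle : edist ((extChartAt (𝓡 n) x).symm a) ((extChartAt (𝓡 n) x).symm b) ≤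
      pathELength (𝓡 n) γ 0 1 := by
    rw [IsRiemannianManifold.out (I := 𝓡 n)]
    apply riemannianEDist_le_pathELength _ _ _ zero_le_one
    · exact (contMDiffOn_extChartAt_symm x).comp η_smooth
        (hη.trans (preimage_mono (hball.trans inter_subset_right)))
    · simp [γ, η, ContinuousAffineMap.coe_lineMap_eq]
    · simp [γ, η, ContinuousAffineMap.coe_lineMap_eq]
  have hlen : pathELength (𝓡 n) γ 0 1 ≤ ENNReal.ofReal (2 * tanNorm n x (a - b)) := by
    rw [pathELength_eq_lintegral_mfderivWithin_Icc]
    have : ∫⁻ t in Icc (0 : ℝ) 1, ENNReal.ofReal (2 * tanNorm n x (a - b)) =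
        ENNReal.ofReal (2 * tanNorm n x (a - b)) := by simp
    rw [← this]
    apply setLIntegral_mono' measurableSet_Icc (fun t ht ↦ ?_)
    have h1 : mfderivWithin 𝓘(ℝ, ℝ) (𝓡 n) γ (Icc 0 1) t =
        (mfderiv (𝓡 n) (𝓡 n) (extChartAt (𝓡 n) x).symm (η t)) ∘L
          (mfderivWithin 𝓘(ℝ, ℝ) (𝓡 n) η (Icc 0 1) t) := by
      apply mfderiv_comp_mfderivWithin
      · have := (contMDiffOn_extChartAt_symm (I := 𝓡 n) (n := 1) x).contMDiffAt
          ((isOpen_extChartAt_target x).mem_nhds (hball (hη ht)).2)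
        exact this.mdifferentiableAt one_ne_zero
      · exact η_smooth.mdifferentiableOn one_ne_zero t ht
      · rw [uniqueMDiffWithinAt_iff_uniqueDiffWithinAt]
        exact uniqueDiffOn_Icc zero_lt_one t ht
    have h2 : mfderivWithin 𝓘(ℝ, ℝ) (𝓡 n) η (Icc 0 1) t (1 : ℝ) = b - a := by
      have : fderivWithin ℝ η (Icc 0 1) t 1 = b - a := by
        rw [fderivWithin_eq_fderiv (uniqueDiffOn_Icc zero_lt_one t ht)
          (ContinuousAffineMap.differentiable _).differentiableAt]
        simp [η]
      rw [← mfderivWithin_eq_fderivWithin] at this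
      exact this
    have h3 := (hball (hη ht)).1 (b - a)
    have h4 : mfderivWithin 𝓘(ℝ, ℝ) (𝓡 n) γ (Icc 0 1) t (1 : ℝ) =
      mfderiv (𝓡 n) (𝓡 n) (extChartAt (𝓡 n) x).symm (η t) (b - a) :=
      (DFunLike.congr_fun h1 (1 : ℝ)).trans (congrArg _ h2)
    have h5 : ‖mfderivWithin 𝓘(ℝ, ℝ) (𝓡 n) γ (Icc 0 1) t (1 : ℝ)‖ ≤ 2 * tanNorm n x (a - b) := by
      rw [tanNorm_sub_comm]
      exact (congrArg norm h4).le.trans h3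
    rw [← ofReal_norm]
    exact ENNReal.ofReal_le_ofReal h5
  have := hle.trans hlen
  rwa [edist_dist, ENNReal.ofReal_le_ofReal_iff
    (mul_nonneg zero_le_two (tanNorm_nonneg x _))] at this

end

/-! ### Lipschitz functions and local approximation -/

section

variable {n : ℕ} {M : Type*} [MetricSpace M]
    [ChartedSpace (EuclideanSpace ℝ (Fin n)) M] [IsManifold (𝓡 n) ∞ M]
    [RiemannianBundle (fun x : M ↦ TangentSpace (𝓡 n) x)]

local notation "𝔼" => EuclideanSpace ℝ (Fin n)

variable [IsContinuousRiemannianBundle (EuclideanSpace ℝ (Fin n))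
  (fun x : M ↦ TangentSpace (𝓡 n) x)]
  [IsRiemannianManifold (𝓡 n) M]

/-- Differentiate along the coordinate line `a + t w`. The inverse chart stretches by at most 2,
which is where the non-sharp factor comes from. -/
theorem gradLength_le_of_lipschitzOnWith {u : M → ℝ} {x : M}
    (hu : MDifferentiableAt (𝓡 n) 𝓘(ℝ, ℝ) u x) {L : ℝ≥0} {U : Set M} (hU : U ∈ 𝓝 x)
    (hL : LipschitzOnWith L u U) : gradLength n u x ≤ 2 * L := by
  have main : ‖mvfderiv (𝓡 n) u x‖ ≤ 2 * L := by
    refine ContinuousLinearMap.opNorm_le_bound _ (by positivity) fun v ↦ ?_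
    obtain ⟨r, hr, hsub, hcmp⟩ := exists_dist_extChartAt_symm_le (n := n) x
    set a := extChartAt (𝓡 n) x x with ha
    set w : 𝔼 := v
    have hd : HasFDerivAt (u ∘ (extChartAt (𝓡 n) x).symm) (mvfderiv (𝓡 n) u x : 𝔼 →L[ℝ] ℝ) a := by
      have h1 := hu.hasMFDerivAt.2
      simp only [modelWithCornersSelf_coe, range_id] at h1
      exact HasFDerivWithinAt.hasFDerivAt h1 Filter.univ_mem
    have hline : HasDerivAt (fun t : ℝ ↦ (u ∘ (extChartAt (𝓡 n) x).symm) (a + t • w))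
        ((mvfderiv (𝓡 n) u x : 𝔼 →L[ℝ] ℝ) w) 0 := hd.hasLineDerivAt w
    refine hline.le_of_lip' (C := 2 * L * tanNorm n x w)
      (mul_nonneg (by positivity) (tanNorm_nonneg x w)) ?_
    have hc : ContinuousAt (fun t : ℝ ↦ a + t • w) 0 := by fun_prop
    have hc0 : a + (0 : ℝ) • w = a := by simp
    have hc2 : ContinuousAt (fun t : ℝ ↦ (extChartAt (𝓡 n) x).symm (a + t • w)) 0 := by
      refine ContinuousAt.comp (f := fun t : ℝ ↦ a + t • w) ?_ hc
      rw [hc0]; exact continuousAt_extChartAt_symm x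
    have hx : (extChartAt (𝓡 n) x).symm a = x := extChartAt_to_inv x
    have e1 := hc.preimage_mem_nhds (by rw [hc0]; exact Metric.ball_mem_nhds a hr)
    have e2 := hc2.preimage_mem_nhds (by rw [hc0, hx]; exact hU)
    filter_upwards [e1, e2] with t h1 h2
    have h3 := hL.dist_le_mul _ h2 _ (mem_of_mem_nhds hU)
    have h4 := hcmp _ h1 _ (Metric.mem_ball_self hr)
    rw [hx, add_sub_cancel_left, tanNorm_smul] at h4
    simp only [Function.comp_apply, hc0, hx, sub_zero, Real.norm_eq_abs]
    rw [Real.dist_eq] at h3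
    refine h3.trans ?_
    calc (L : ℝ) * dist ((extChartAt (𝓡 n) x).symm (a + t • w)) x
        ≤ L * (2 * (|t| * tanNorm n x w)) := by gcongr
      _ = _ := by ring
  unfold gradLength
  rw [← ofReal_norm]
  refine (ENNReal.ofReal_le_ofReal main).trans (le_of_eq ?_)
  rw [ENNReal.ofReal_mul zero_le_two, ENNReal.ofReal_coe_nnreal]
  simp

theorem locallyLipschitz_of_contMDiff {u : M → ℝ} (hu : ContMDiff (𝓡 n) 𝓘(ℝ, ℝ) 1 u) :
    LocallyLipschitz u := by
  intro x
  obtain ⟨r, hr, hsub, hcmp⟩ := exists_tanNorm_extChartAt_sub_le (n := n) x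
  obtain ⟨C, hC⟩ := exists_norm_le_tanNorm (n := n) x
  have h1 : ContDiffAt ℝ 1 (u ∘ (extChartAt (𝓡 n) x).symm) (extChartAt (𝓡 n) x x) := by
    have h1 := (contMDiffAt_iff.1 (hu x)).2
    simp only [modelWithCornersSelf_coe, range_id, contDiffWithinAt_univ] at h1
    exact h1
  obtain ⟨K, s, hs, hK⟩ := h1.exists_lipschitzOnWith
  refine ⟨K * (C * 2), Metric.ball x r ∩ (extChartAt (𝓡 n) x) ⁻¹' s,
    Filter.inter_mem (Metric.ball_mem_nhds x hr)
      ((continuousAt_extChartAt x).preimage_mem_nhds hs), ?_⟩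
  have hφ : LipschitzOnWith (C * 2) (extChartAt (𝓡 n) x)
      (Metric.ball x r ∩ (extChartAt (𝓡 n) x) ⁻¹' s) := by
    refine LipschitzOnWith.of_dist_le_mul fun p hp q hq ↦ ?_
    rw [dist_eq_norm]
    refine (hC _).trans ?_
    have := hcmp p hp.1 q hq.1
    push_cast
    rw [mul_assoc]
    gcongr
  have hinv : ∀ p ∈ Metric.ball x r, (extChartAt (𝓡 n) x).symm (extChartAt (𝓡 n) x p) = p :=
    fun p hp ↦ (extChartAt (𝓡 n) x).left_inv (by simpa [extChartAt_source] using hsub hp)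
  intro p hp q hq
  have := (hK.comp hφ (fun p hp ↦ hp.2)) hp hq
  simpa only [Function.comp_apply, hinv p hp.1, hinv q hq.1] using this

/-- Mollify `f` in the chart. Going to the frozen norm and back costs a factor 2 each way, hence `4
L`. The radius is chosen before `δ`, so the accuracy can be fixed after a partition of unity on
these balls. -/
theorem exists_local_approx {f : M → ℝ} {L : ℝ≥0} (hf : LipschitzWith L f) (x : M) :
    ∃ r > 0, ∀ δ : ℝ, 0 < δ → ∃ g : M → ℝ, ContMDiffOn (𝓡 n) 𝓘(ℝ, ℝ) 1 g (Metric.ball x r) ∧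
      (∀ p ∈ Metric.ball x r, |g p - f p| ≤ δ) ∧ LipschitzOnWith (4 * L) g (Metric.ball x r) := by
  obtain ⟨r₁, hr₁, hsrc, hlow⟩ := exists_tanNorm_extChartAt_sub_le (n := n) x
  obtain ⟨r₂, hr₂, htgt, hup⟩ := exists_dist_extChartAt_symm_le (n := n) x
  obtain ⟨C, hC⟩ := exists_tanNorm_le (n := n) x
  set φ := extChartAt (𝓡 n) x with hφ
  set a₀ := φ x with ha₀
  -- A crude Euclidean Lipschitz constant, with `C` uncontrolled. It serves only to extend `f` off
  -- the chart ball and to choose the mollification scale, not in the final constant.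
  have hG0 : LipschitzOnWith (L * (2 * C)) (fun a ↦ f (φ.symm a)) (Metric.ball a₀ r₂) := by
    refine LipschitzOnWith.of_dist_le_mul fun a ha b hb ↦ ?_
    refine (hf.dist_le_mul _ _).trans ?_
    have h1 := hup a ha b hb
    have h2 := hC (a - b)
    rw [dist_eq_norm a b]
    push_cast
    rw [mul_assoc, mul_assoc]
    gcongr
    exact h1.trans (by gcongr)
  obtain ⟨G, hG, hGeq⟩ := hG0.extend_real
  have hGf : ∀ a ∈ Metric.ball a₀ r₂, G a = f (φ.symm a) := fun a ha ↦ (hGeq ha).symm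
  obtain ⟨r₃, hr₃, hr₃'⟩ :=
    Metric.mem_nhds_iff.1 ((continuousAt_extChartAt (I := 𝓡 n) x).preimage_mem_nhds
    (Metric.ball_mem_nhds a₀ (half_pos hr₂)))
  refine ⟨min r₁ r₃, lt_min hr₁ hr₃, fun δ hδ ↦ ?_⟩
  -- The first bound keeps translates inside the chart ball, the second makes the mollification
  -- error at most `δ`; the `+ 1` avoids division by zero.
  set s : ℝ := min (r₂ / 2) (δ / (L * (2 * C) + 1)) with hs
  have hs0 : 0 < s := lt_min (half_pos hr₂) (by positivity)
  let ρ : ContDiffBump (0 : 𝔼) := ⟨s / 2, s, half_pos hs0, half_lt_self hs0⟩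
  let g := convolution (ρ.normed volume) G (ContinuousLinearMap.lsmul ℝ ℝ) volume
  have hgsm : ContDiff ℝ 1 g :=
    ρ.hasCompactSupport_normed.contDiff_convolution_left _ ρ.contDiff_normed
      hG.continuous.locallyIntegrable
  have hint : ∀ a, Integrable (fun t ↦ ρ.normed volume t • G (a - t)) := fun a ↦ by
    refine Continuous.integrable_of_hasCompactSupport ?_ ?_
    · exact ρ.continuous_normed.smul (hG.continuous.comp (by fun_prop))
    · exact ρ.hasCompactSupport_normed.smul_right
  have hgdef : ∀ a, g a = ∫ t, ρ.normed volume t • G (a - t) := fun a ↦ rfl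
  have hρs : ∀ t, ρ.normed volume t ≠ 0 → ‖t‖ < s := fun t ht ↦ by
    have : t ∈ Function.support (ρ.normed volume) := ht
    rw [ρ.support_normed_eq] at this
    simpa using this
  have hclose : ∀ a, |g a - G a| ≤ δ := fun a ↦ by
    rw [← Real.dist_eq]
    refine ρ.dist_normed_convolution_le hG.continuous.aestronglyMeasurable (fun b hb ↦ ?_)
    refine (hG.dist_le_mul _ _).trans ?_
    have hb' : dist b a ≤ δ / (L * (2 * C) + 1) := (le_of_lt hb).trans (min_le_right _ _)
    push_cast
    calc (L * (2 * C) : ℝ) * dist b a ≤ (L * (2 * C) + 1) * (δ / (L * (2 * C) + 1)) := by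
          gcongr; linarith
      _ = δ := by field_simp
  -- The frozen norm is translation invariant, so averaging translates preserves the Lipschitz bound
  -- `2 L` in that norm, without the constant `C`.
  have hlip : ∀ a ∈ Metric.ball a₀ (r₂ / 2), ∀ b ∈ Metric.ball a₀ (r₂ / 2),
      |g a - g b| ≤ 2 * L * tanNorm n x (a - b) := fun a ha b hb ↦ by
    rw [hgdef, hgdef, ← integral_sub (hint a) (hint b), ← Real.norm_eq_abs]
    have hbd : ∀ t, ‖ρ.normed volume t • G (a - t) - ρ.normed volume t • G (b - t)‖ ≤
        ρ.normed volume t * (2 * L * tanNorm n x (a - b)) := fun t ↦ by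
      by_cases ht : ρ.normed volume t = 0
      · simp [ht]
      have hts : ‖t‖ < r₂ / 2 := (hρs t ht).trans_le (min_le_left _ _)
      have hmem : ∀ c ∈ Metric.ball a₀ (r₂ / 2), c - t ∈ Metric.ball a₀ r₂ := fun c hc ↦ by
        rw [Metric.mem_ball, dist_eq_norm] at hc ⊢
        calc ‖c - t - a₀‖ = ‖(c - a₀) - t‖ := by congr 1; abel
          _ ≤ ‖c - a₀‖ + ‖t‖ := norm_sub_le _ _
          _ < r₂ := by linarith
      rw [← smul_sub, norm_smul, Real.norm_eq_abs, abs_of_nonneg (ρ.nonneg_normed t)]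
      refine mul_le_mul_of_nonneg_left ?_ (ρ.nonneg_normed t)
      rw [hGf _ (hmem a ha), hGf _ (hmem b hb), ← dist_eq_norm]
      refine (hf.dist_le_mul _ _).trans ?_
      have := hup _ (hmem a ha) _ (hmem b hb)
      rw [sub_sub_sub_cancel_right] at this
      calc (L : ℝ) * _ ≤ L * (2 * tanNorm n x (a - b)) := by gcongr
        _ = _ := by ring
    refine (norm_integral_le_of_norm_le (ρ.integrable_normed.mul_const _)
      (Filter.Eventually.of_forall hbd)).trans ?_
    rw [integral_mul_const, ρ.integral_normed, one_mul]
  have hmaps : ∀ p ∈ Metric.ball x (min r₁ r₃), φ p ∈ Metric.ball a₀ (r₂ / 2) := fun p hp ↦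
    hr₃' (Metric.ball_subset_ball (min_le_right _ _) hp)
  have hsub : Metric.ball x (min r₁ r₃) ⊆ (chartAt 𝔼 x).source :=
    (Metric.ball_subset_ball (min_le_left _ _)).trans hsrc
  refine ⟨g ∘ φ, ?_, fun p hp ↦ ?_, LipschitzOnWith.of_dist_le_mul fun p hp q hq ↦ ?_⟩
  · exact hgsm.contMDiff.comp_contMDiffOn (contMDiffOn_extChartAt.mono hsub)
  · have h1 := hclose (φ p)
    rw [hGf _ (Metric.ball_subset_ball (by linarith) (hmaps p hp)), φ.left_inv] at h1
    · exact h1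
    · simpa [hφ, extChartAt_source] using hsub hp
  · rw [Real.dist_eq]
    refine (hlip _ (hmaps p hp) _ (hmaps q hq)).trans ?_
    have := hlow p (Metric.ball_subset_ball (min_le_left _ _) hp) q
      (Metric.ball_subset_ball (min_le_left _ _) hq)
    push_cast
    calc (2 * L : ℝ) * _ ≤ 2 * L * (2 * dist p q) := by gcongr
      _ = _ := by ring

end

/-! ### Smooth approximation and bump functions -/

section

variable {n : ℕ} {M : Type*} [MetricSpace M]
    [ChartedSpace (EuclideanSpace ℝ (Fin n)) M] [IsManifold (𝓡 n) ∞ M]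
    [RiemannianBundle (fun x : M ↦ TangentSpace (𝓡 n) x)]

local notation "𝔼" => EuclideanSpace ℝ (Fin n)

variable [IsContinuousRiemannianBundle (EuclideanSpace ℝ (Fin n))
  (fun x : M ↦ TangentSpace (𝓡 n) x)]
  [IsRiemannianManifold (𝓡 n) M]

theorem exists_lipschitzOnWith_nhds_of_isCompact {Y : Type*} [PseudoMetricSpace Y] {u : Y → ℝ}
    (hu : LocallyLipschitz u) {K : Set Y} (hK : IsCompact K) :
    ∃ C : ℝ≥0, ∀ p ∈ K, ∃ U ∈ 𝓝 p, LipschitzOnWith C u U := by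
  refine hK.induction_on (p := fun s ↦ ∃ C : ℝ≥0, ∀ p ∈ s, ∃ U ∈ 𝓝 p, LipschitzOnWith C u U)
    ⟨0, by simp⟩ (fun s t hst ⟨C, hC⟩ ↦ ⟨C, fun p hp ↦ hC p (hst hp)⟩) ?_ (fun x _ ↦ ?_)
  · rintro s t ⟨C, hC⟩ ⟨D, hD⟩
    refine ⟨max C D, fun p hp ↦ ?_⟩
    rcases hp with hp | hp
    · obtain ⟨U, hU, h⟩ := hC p hp
      exact ⟨U, hU, h.weaken (le_max_left _ _)⟩
    · obtain ⟨U, hU, h⟩ := hD p hp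
      exact ⟨U, hU, h.weaken (le_max_right _ _)⟩
  · obtain ⟨C, U, hU, h⟩ := hu x
    refine ⟨interior U, mem_nhdsWithin_of_mem_nhds (interior_mem_nhds.2 hU), C, fun p hp ↦ ?_⟩
    exact ⟨U, mem_interior_iff_mem_nhds.1 hp, h⟩

/-- Glue local approximations as `∑ χ_i g_i`. Differentiating the `χ_i` produces only the terms
`(χ_i q - χ_i q') (g_i - f)`, because `∑ (χ_i q - χ_i q') = 0`. Taking the `g_i` close enough to
`f`, after the partition is fixed, makes these cost at most one more `L` beyond `4 L`. -/
theorem exists_contMDiff_approx [ProperSpace M] {f : M → ℝ} {L : ℝ≥0} (hf : LipschitzWith L f)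
    (hL : 0 < L) {K : Set M} (hK : IsCompact K) {δ : ℝ} (hδ : 0 < δ) :
    ∃ g : M → ℝ, ContMDiff (𝓡 n) 𝓘(ℝ, ℝ) 1 g ∧ (∀ p ∈ K, |g p - f p| ≤ δ) ∧
      ∀ p ∈ interior K, ∃ U ∈ 𝓝 p, LipschitzOnWith (5 * L) g U := by
  choose r hr hloc using exists_local_approx (n := n) hf
  obtain ⟨t, -, htK⟩ := hK.elim_nhds_subcover (fun x ↦ Metric.ball x (r x))
    (fun x _ ↦ Metric.ball_mem_nhds x (hr x))
  obtain ⟨χ, hχ⟩ := SmoothPartitionOfUnity.exists_isSubordinate (𝓡 n) hK.isClosed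
    (fun i : t ↦ Metric.ball (i : M) (r i)) (fun i ↦ Metric.isOpen_ball)
    (fun p hp ↦ by
      obtain ⟨x, hx, hpx⟩ := mem_iUnion₂.1 (htK hp)
      exact mem_iUnion.2 ⟨⟨x, hx⟩, hpx⟩)
  have hχsm : ∀ i, ContMDiff (𝓡 n) 𝓘(ℝ, ℝ) 1 (χ i) := fun i ↦ (χ i).contMDiff.of_le (by simp)
  have hχsum : ∀ p ∈ K, ∑ i, χ i p = 1 := fun p hp ↦ by
    have := χ.sum_eq_one hp
    rwa [finsum_eq_sum_of_fintype] at this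
  choose κ hκ using fun i ↦ exists_lipschitzOnWith_nhds_of_isCompact
    (locallyLipschitz_of_contMDiff (n := n) (hχsm i)) hK
  set S : ℝ := ∑ i, (κ i : ℝ) with hS
  have hS0 : 0 ≤ S := Finset.sum_nonneg fun i _ ↦ (κ i).2
  set η : ℝ := min δ (L / (S + 1)) with hη
  have hη0 : 0 < η := lt_min hδ (by positivity)
  choose g hgsm hgf hgl using fun i : t ↦ hloc i η hη0
  have hterm : ∀ i, ContMDiff (𝓡 n) 𝓘(ℝ, ℝ) 1 (fun p ↦ χ i p * g i p) := fun i ↦ by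
    refine contMDiff_of_tsupport fun p hp ↦ ?_
    have hp' : p ∈ tsupport (χ i) := closure_mono (Function.support_mul_subset_left _ _) hp
    have h1 : ContMDiffAt (𝓡 n) 𝓘(ℝ, ℝ) 1 (g i) p :=
      (hgsm i).contMDiffAt (Metric.isOpen_ball.mem_nhds (hχ i hp'))
    exact (hχsm i p).mul h1
  have hχg : ∀ i p, χ i p ≠ 0 → p ∈ Metric.ball (i : M) (r i) := fun i p hp ↦
    hχ i (subset_tsupport _ hp)
  refine ⟨fun p ↦ ∑ i, χ i p * g i p, contMDiff_finsetSum fun i _ ↦ hterm i,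
    fun p hp ↦ ?_, fun p hp ↦ ?_⟩
  · have : ∑ i, χ i p * g i p - f p = ∑ i, χ i p * (g i p - f p) := by
      simp_rw [mul_sub, Finset.sum_sub_distrib]
      rw [← Finset.sum_mul, hχsum p hp, one_mul]
    rw [this]
    refine (Finset.abs_sum_le_sum_abs _ _).trans ?_
    calc ∑ i, |χ i p * (g i p - f p)| ≤ ∑ i, χ i p * δ := by
          refine Finset.sum_le_sum fun i _ ↦ ?_
          rw [abs_mul, abs_of_nonneg (χ.nonneg i p)]
          by_cases h : χ i p = 0
          · simp [h]
          · exact mul_le_mul_of_nonneg_left ((hgf i p (hχg i p h)).trans (min_le_left _ _))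
              (χ.nonneg i p)
      _ = δ := by rw [← Finset.sum_mul, hχsum p hp, one_mul]
  · have hpK := interior_subset hp
    -- Near `p`, an index can contribute only if `p` lies in its ball, and then a whole
    -- neighbourhood of `p` does too, so the estimates for `g_i` apply there.
    have h1 : ∀ i, ∀ᶠ q in 𝓝 p, (χ i q ≠ 0 → p ∈ Metric.ball (i : M) (r i)) := fun i ↦ by
      by_cases h : p ∈ tsupport (χ i)
      · exact Filter.Eventually.of_forall fun q _ ↦ hχ i h
      · have : (tsupport (χ i))ᶜ ∈ 𝓝 p := (isClosed_tsupport _).isOpen_compl.mem_nhds h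
        filter_upwards [this] with q hq hq'
        exact absurd (subset_tsupport _ hq') hq
    have h2 : ∀ i : t, ∀ᶠ q in 𝓝 p,
        (p ∈ Metric.ball (i : M) (r i) → q ∈ Metric.ball (i : M) (r i)) :=
      fun i ↦ by
        by_cases h : p ∈ Metric.ball (i : M) (r i)
        · filter_upwards [Metric.isOpen_ball.mem_nhds h] with q hq _ using hq
        · exact Filter.Eventually.of_forall fun q hq ↦ absurd hq h
    choose U hU hUl using fun i ↦ hκ i p hpK
    have hU' : ∀ᶠ q in 𝓝 p, ∀ i, q ∈ U i := Filter.eventually_all.2 fun i ↦ hU i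
    have h3 : ∀ᶠ q in 𝓝 p, q ∈ interior K ∧ (∀ i, χ i q ≠ 0 → p ∈ Metric.ball (i : M) (r i)) ∧
        (∀ i : t, p ∈ Metric.ball (i : M) (r i) → q ∈ Metric.ball (i : M) (r i)) ∧
        ∀ i, q ∈ U i := by
      filter_upwards [isOpen_interior.mem_nhds hp, Filter.eventually_all.2 h1,
        Filter.eventually_all.2 h2, hU'] with q a b c d using ⟨a, b, c, d⟩
    refine ⟨_, h3, LipschitzOnWith.of_dist_le_mul fun q hq q' hq' ↦ ?_⟩
    have hqK := hχsum q (interior_subset hq.1)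
    have hqK' := hχsum q' (interior_subset hq'.1)
    have hdecomp : ∑ i, χ i q * g i q - ∑ i, χ i q' * g i q' =
        ∑ i, (χ i q * (g i q - g i q') + (χ i q - χ i q') * (g i q' - f q')) := by
      have : ∑ i, (χ i q - χ i q') * f q' = 0 := by
        rw [← Finset.sum_mul, Finset.sum_sub_distrib, hqK, hqK', sub_self, zero_mul]
      rw [← Finset.sum_sub_distrib, ← sub_zero (∑ i, (χ i q * g i q - χ i q' * g i q')), ← this,
        ← Finset.sum_sub_distrib]
      exact Finset.sum_congr rfl fun i _ ↦ by ring
    rw [Real.dist_eq, hdecomp]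
    refine (Finset.abs_sum_le_sum_abs _ _).trans ?_
    calc ∑ i, |χ i q * (g i q - g i q') + (χ i q - χ i q') * (g i q' - f q')|
        ≤ ∑ i, (χ i q * (4 * L * dist q q') + κ i * (dist q q' * η)) := by
          refine Finset.sum_le_sum fun i _ ↦ (abs_add_le _ _).trans (add_le_add ?_ ?_)
          · rw [abs_mul, abs_of_nonneg (χ.nonneg i q)]
            by_cases h : χ i q = 0
            · simp [h]
            · have hpi := hq.2.1 i h
              have := (hgl i).dist_le_mul q (hq.2.2.1 i hpi) q' (hq'.2.2.1 i hpi)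
              rw [Real.dist_eq] at this
              exact mul_le_mul_of_nonneg_left this (χ.nonneg i q)
          · rw [abs_mul, ← mul_assoc]
            have hl := (hUl i).dist_le_mul q (hq.2.2.2 i) q' (hq'.2.2.2 i)
            rw [Real.dist_eq] at hl
            by_cases hpi : p ∈ Metric.ball (i : M) (r i)
            · exact mul_le_mul hl (hgf i q' (hq'.2.2.1 i hpi)) (abs_nonneg _) (by positivity)
            · have e1 : χ i q = 0 := by_contra fun h ↦ hpi (hq.2.1 i h)
              have e2 : χ i q' = 0 := by_contra fun h ↦ hpi (hq'.2.1 i h)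
              rw [e1, e2]
              simp only [sub_self, abs_zero, zero_mul]
              positivity
      _ = 4 * L * dist q q' + S * η * dist q q' := by
          rw [Finset.sum_add_distrib, ← Finset.sum_mul, hqK, one_mul, ← Finset.sum_mul]
          ring
      _ ≤ 4 * L * dist q q' + L * dist q q' := by
          have : S * η ≤ L := by
            calc S * η ≤ (S + 1) * (L / (S + 1)) := by
                  gcongr
                  · linarith
                  · exact min_le_right _ _
              _ = L := by field_simp
          gcongr
      _ = (5 * L : ℝ≥0) * dist q q' := by push_cast; ring

variable (n M) in
/-- Bump functions of class `C¹` at a fixed scale, with a common local Lipschitz constant. -/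
theorem exists_bump [ProperSpace M] {ε : ℝ} (hε : 0 < ε) :
    ∃ Λ : ℝ≥0, ∀ x : M, ∃ φ : M → ℝ, ContMDiff (𝓡 n) 𝓘(ℝ, ℝ) 1 φ ∧ (∀ p, 0 ≤ φ p) ∧
      (∀ p, φ p ≤ 1) ∧ (∀ p ∈ Metric.ball x ε, φ p = 1) ∧
      (∀ p ∉ Metric.ball x (2 * ε), φ p = 0) ∧ ∀ p, ∃ U ∈ 𝓝 p, LipschitzOnWith Λ φ U := by
  -- The model function `4 - (3/ε) d(·, x)` lies in `[1, 4]` on `B(x, ε)` and is at most `-2` off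
  -- `B(x, 2ε)`. With an approximation error `1/2`, the first case stays within `7/2` of 4 and the
  -- second is farther than 5 from 4.
  let b : ContDiffBump (4 : ℝ) := ⟨7 / 2, 5, by norm_num, by norm_num⟩
  obtain ⟨B, hB⟩ := (b.contDiff (n := 1)).lipschitzWith_of_hasCompactSupport b.hasCompactSupport
    one_ne_zero
  set L : ℝ≥0 := (3 / ε).toNNReal with hLdef
  have hLc : (L : ℝ) = 3 / ε := Real.coe_toNNReal _ (by positivity)
  have hL : 0 < L := by rw [hLdef, Real.toNNReal_pos]; positivity
  refine ⟨B * (5 * L), fun x ↦ ?_⟩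
  have hf : LipschitzWith L (fun p ↦ 4 - 3 / ε * dist p x) := by
    refine LipschitzWith.of_dist_le_mul fun p q ↦ ?_
    rw [Real.dist_eq, hLc]
    have h1 : (4 - 3 / ε * dist p x) - (4 - 3 / ε * dist q x) =
      - (3 / ε) * (dist p x - dist q x) := by ring
    rw [h1, abs_mul, abs_neg, abs_of_pos (by positivity : 0 < 3 / ε)]
    exact mul_le_mul_of_nonneg_left (abs_dist_sub_le _ _ _) (by positivity)
  obtain ⟨g, hgsm, hgf, hgl⟩ := exists_contMDiff_approx (n := n) hf hL
    (isCompact_closedBall x (3 * ε)) (by norm_num : (0 : ℝ) < 1 / 2)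
  have hout : ∀ p ∈ Metric.closedBall x (3 * ε), p ∉ Metric.ball x (2 * ε) → b (g p) = 0 := by
    intro p hp hp2
    have h1 := (abs_le.1 (hgf p hp)).2
    simp only [Metric.mem_ball, not_lt] at hp2
    have h2 : 6 ≤ 3 / ε * dist p x := by
      calc (6 : ℝ) = 3 / ε * (2 * ε) := by field_simp; norm_num
        _ ≤ _ := by gcongr
    refine b.zero_of_le_dist ?_
    rw [Real.dist_eq]
    refine le_trans ?_ (neg_le_abs _)
    show (5 : ℝ) ≤ _
    linarith
  classical
  -- The approximation is controlled only near `B(x, 3ε)`; `b ∘ g` already vanishes on the annulus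
  -- beyond `2ε`, so extension by zero remains `C¹`.
  let φ : M → ℝ := fun p ↦ if p ∈ Metric.ball x (3 * ε) then b (g p) else 0
  have hin : ∀ p ∈ Metric.ball x (3 * ε), φ =ᶠ[𝓝 p] fun q ↦ b (g q) := fun p hp ↦ by
    filter_upwards [Metric.isOpen_ball.mem_nhds hp] with q hq
    exact if_pos hq
  have hzero : ∀ q ∉ Metric.ball x (2 * ε), φ q = 0 := fun q hq ↦ by
    by_cases h : q ∈ Metric.ball x (3 * ε)
    · exact (if_pos h).trans (hout q (Metric.ball_subset_closedBall h) hq)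
    · exact if_neg h
  have hoff : ∀ p ∉ Metric.ball x (3 * ε), φ =ᶠ[𝓝 p] fun _ ↦ 0 := fun p hp ↦ by
    have : p ∈ (Metric.closedBall x (2 * ε))ᶜ := by
      simp only [Metric.mem_ball, not_lt, mem_compl_iff, Metric.mem_closedBall, not_le] at hp ⊢
      linarith
    filter_upwards [Metric.isClosed_closedBall.isOpen_compl.mem_nhds this] with q hq
    exact hzero q fun h ↦ hq (Metric.ball_subset_closedBall h)
  refine ⟨φ, fun p ↦ ?_, fun p ↦ ?_, fun p ↦ ?_, fun p hp ↦ ?_, hzero, fun p ↦ ?_⟩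
  · by_cases hp : p ∈ Metric.ball x (3 * ε)
    · refine ContMDiffAt.congr_of_eventuallyEq ?_ (hin p hp)
      exact (b.contDiff (n := 1)).contMDiff.contMDiffAt.comp p (hgsm p)
    · exact contMDiffAt_const.congr_of_eventuallyEq (hoff p hp)
  · simp only [φ]; split_ifs
    · exact b.nonneg
    · exact le_rfl
  · simp only [φ]; split_ifs
    · exact b.le_one
    · exact zero_le_one
  · rw [Metric.mem_ball] at hp
    have hp3 : p ∈ Metric.ball x (3 * ε) := by rw [Metric.mem_ball]; linarith
    refine (if_pos hp3).trans (b.one_of_mem_closedBall ?_)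
    have h1 := abs_le.1 (hgf p (Metric.ball_subset_closedBall hp3))
    have h2 : 3 / ε * dist p x ≤ 3 := by
      calc 3 / ε * dist p x ≤ 3 / ε * ε := by gcongr
        _ = 3 := by field_simp
    have h3 : 0 ≤ 3 / ε * dist p x := by positivity
    rw [Metric.mem_closedBall, Real.dist_eq, abs_le]
    show -(7 / 2 : ℝ) ≤ _ ∧ _ ≤ (7 / 2 : ℝ)
    constructor <;> linarith
  · by_cases hp : p ∈ Metric.ball x (3 * ε)
    · obtain ⟨U, hU, hUl⟩ := hgl p
        (mem_interior_iff_mem_nhds.2 (Filter.mem_of_superset (Metric.isOpen_ball.mem_nhds hp)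
          Metric.ball_subset_closedBall))
      refine ⟨U ∩ Metric.ball x (3 * ε), Filter.inter_mem hU (Metric.isOpen_ball.mem_nhds hp), ?_⟩
      intro q hq q' hq'
      simp only [φ, if_pos hq.2, if_pos hq'.2]
      exact (hB.comp_lipschitzOnWith hUl) hq.1 hq'.1
    · refine ⟨_, hoff p hp, fun q hq q' hq' ↦ ?_⟩
      rw [mem_ofPred_eq] at hq hq'
      simp [hq, hq']

end

/-! ### The Riemannian volume -/

section

variable {n : ℕ} {M : Type*} [MetricSpace M]
    [ChartedSpace (EuclideanSpace ℝ (Fin n)) M] [IsManifold (𝓡 n) ∞ M]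
    [RiemannianBundle (fun x : M ↦ TangentSpace (𝓡 n) x)]

local notation "𝔼" => EuclideanSpace ℝ (Fin n)

/-- The Gram matrix of the images of the standard basis under a linear map into a tangent space. -/
noncomputable def gramAt (p : M) (D : 𝔼 →L[ℝ] 𝔼) : Matrix (Fin n) (Fin n) ℝ :=
  Matrix.gram ℝ fun i ↦ (show TangentSpace (𝓡 n) p from D (EuclideanSpace.single i (1 : ℝ)))

theorem chartGram_eq_gramAt (φ : OpenPartialHomeomorph M 𝔼) (y : 𝔼) :
    chartGram φ y = gramAt (φ.symm y) (mfderiv (𝓡 n) (𝓡 n) φ.symm y : 𝔼 →L[ℝ] 𝔼) := rfl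

theorem gramAt_comp (p : M) (D J : 𝔼 →L[ℝ] 𝔼) :
    gramAt p (D.comp J) =
      (LinearMap.toMatrix (EuclideanSpace.basisFun (Fin n) ℝ).toBasis
        (EuclideanSpace.basisFun (Fin n) ℝ).toBasis (J : 𝔼 →ₗ[ℝ] 𝔼)).transpose * gramAt p D *
      LinearMap.toMatrix (EuclideanSpace.basisFun (Fin n) ℝ).toBasis
        (EuclideanSpace.basisFun (Fin n) ℝ).toBasis (J : 𝔼 →ₗ[ℝ] 𝔼) := by
  set b := (EuclideanSpace.basisFun (Fin n) ℝ).toBasis with hb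
  set T := LinearMap.toMatrix b b (J : 𝔼 →ₗ[ℝ] 𝔼) with hT
  have hbi : ∀ i, b i = EuclideanSpace.single i (1 : ℝ) := fun i ↦ by simp [hb]
  have hJ : ∀ j, J (EuclideanSpace.single j (1 : ℝ)) =
      ∑ k, T k j • EuclideanSpace.single k (1 : ℝ) := fun j ↦ by
    rw [← hbi]
    have := (b.sum_repr (J (b j))).symm
    refine this.trans (Finset.sum_congr rfl fun k _ ↦ ?_)
    rw [hT, LinearMap.toMatrix_apply, ← hbi k]
    rfl
  let D' : 𝔼 →ₗ[ℝ] TangentSpace (𝓡 n) p := (D : 𝔼 →ₗ[ℝ] 𝔼)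
  have hD : ∀ j, (show TangentSpace (𝓡 n) p from D (J (EuclideanSpace.single j (1 : ℝ)))) =
      ∑ k, T k j • D' (EuclideanSpace.single k (1 : ℝ)) := fun j ↦ by
    have : D' (J (EuclideanSpace.single j (1 : ℝ))) =
        ∑ k, T k j • D' (EuclideanSpace.single k (1 : ℝ)) := by
      rw [hJ, map_sum]
      simp_rw [map_smul]
    exact this
  ext i j
  have e1 : gramAt p (D.comp J) i j = inner ℝ (∑ k, T k i • D' (EuclideanSpace.single k (1 : ℝ)))
      (∑ l, T l j • D' (EuclideanSpace.single l (1 : ℝ))) := by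
    rw [← hD, ← hD]; rfl
  rw [e1, sum_inner, Matrix.mul_apply]
  simp_rw [inner_sum, inner_smul_left, inner_smul_right, Matrix.mul_apply, Matrix.transpose_apply,
    Finset.sum_mul]
  rw [Finset.sum_comm]
  refine Finset.sum_congr rfl fun l _ ↦ Finset.sum_congr rfl fun k _ ↦ ?_
  have e2 : gramAt p D k l = inner ℝ (D' (EuclideanSpace.single k (1 : ℝ)))
    (D' (EuclideanSpace.single l (1 : ℝ))) := rfl
  rw [e2]
  simp only [conj_trivial]
  ring

theorem sqrt_det_gramAt_comp (p : M) (D J : 𝔼 →L[ℝ] 𝔼) :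
    Real.sqrt (gramAt p (D.comp J)).det = |J.det| * Real.sqrt (gramAt p D).det := by
  rw [gramAt_comp, Matrix.det_mul, Matrix.det_mul, Matrix.det_transpose, LinearMap.det_toMatrix]
  have : LinearMap.det (J : 𝔼 →ₗ[ℝ] 𝔼) * (gramAt p D).det * LinearMap.det (J : 𝔼 →ₗ[ℝ] 𝔼) =
    J.det ^ 2 * (gramAt p D).det := by
    change J.det * _ * J.det = _
    ring
  rw [this, Real.sqrt_mul (sq_nonneg _), Real.sqrt_sq_eq_abs]

theorem det_chartGram_pos (c : M) {y : 𝔼} (hy : y ∈ (chartAt 𝔼 c).target) :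
    0 < (chartGram (chartAt 𝔼 c) y).det := by
  have hinj : Function.Injective (mfderiv (𝓡 n) (𝓡 n) (chartAt 𝔼 c).symm y) :=
    (mdifferentiable_chart (I := 𝓡 n) c).symm.mfderiv_injective hy
  refine (Matrix.posDef_gram_of_linearIndependent (𝕜 := ℝ) ?_).det_pos
  have h := (EuclideanSpace.basisFun (Fin n) ℝ).toBasis.linearIndependent
  have h2 := h.map' (mfderiv (𝓡 n) (𝓡 n) (chartAt 𝔼 c).symm y).toLinearMap
    (LinearMap.ker_eq_bot.2 hinj)
  have h3 : LinearIndependent ℝ fun i : Fin n ↦ mfderiv (𝓡 n) (𝓡 n) (chartAt 𝔼 c).symm y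
      (EuclideanSpace.single i (1 : ℝ) : 𝔼) := by
    simp only [Function.comp_def, OrthonormalBasis.coe_toBasis, EuclideanSpace.basisFun_apply] at h2
    exact h2
  exact h3

/-- By the chain rule for `φ⁻¹ = ψ⁻¹ ∘ (ψ ∘ φ⁻¹)` near `y`, the Gram matrix is conjugated as `JᵀGJ`,
so its root determinant picks up `|det J|`, the Jacobian factor of the change of variables formula.
-/
theorem chartGram_change (c d : M) {y : 𝔼} (hy : y ∈ (chartAt 𝔼 c).target)
    (hy' : (chartAt 𝔼 c).symm y ∈ (chartAt 𝔼 d).source) :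
    HasFDerivAt (chartAt 𝔼 d ∘ (chartAt 𝔼 c).symm)
      (fderiv ℝ (chartAt 𝔼 d ∘ (chartAt 𝔼 c).symm) y) y ∧
    Real.sqrt (chartGram (chartAt 𝔼 c) y).det =
      |(fderiv ℝ (chartAt 𝔼 d ∘ (chartAt 𝔼 c).symm) y).det| *
        Real.sqrt (chartGram (chartAt 𝔼 d) (chartAt 𝔼 d ((chartAt 𝔼 c).symm y))).det := by
  set φ := chartAt 𝔼 c
  set ψ := chartAt 𝔼 d
  have h1 : MDifferentiableAt (𝓡 n) (𝓡 n) φ.symm y :=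
    (mdifferentiable_chart (I := 𝓡 n) c).symm.mdifferentiableAt hy
  have h2 : MDifferentiableAt (𝓡 n) (𝓡 n) ψ (φ.symm y) :=
    (mdifferentiable_chart (I := 𝓡 n) d).mdifferentiableAt hy'
  have hτ : MDifferentiableAt (𝓡 n) (𝓡 n) (ψ ∘ φ.symm) y := h2.comp y h1
  have h3 : MDifferentiableAt (𝓡 n) (𝓡 n) ψ.symm ((ψ ∘ φ.symm) y) :=
    (mdifferentiable_chart (I := 𝓡 n) d).symm.mdifferentiableAt (ψ.map_source hy')
  have hfd : DifferentiableAt ℝ (ψ ∘ φ.symm) y := hτ.differentiableAt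
  refine ⟨hfd.hasFDerivAt, ?_⟩
  have heq : φ.symm =ᶠ[𝓝 y] ψ.symm ∘ (ψ ∘ φ.symm) := by
    have hc : ContinuousAt φ.symm y := φ.symm.continuousAt hy
    filter_upwards [hc.preimage_mem_nhds (ψ.open_source.mem_nhds hy')] with z hz
    exact (ψ.left_inv hz).symm
  have h4 : (mfderiv (𝓡 n) (𝓡 n) φ.symm y : 𝔼 →L[ℝ] 𝔼) =
      (mfderiv (𝓡 n) (𝓡 n) ψ.symm ((ψ ∘ φ.symm) y) : 𝔼 →L[ℝ] 𝔼).comp (fderiv ℝ (ψ ∘ φ.symm) y) := by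
    have := heq.mfderiv_eq (I := 𝓡 n) (I' := 𝓡 n)
    have h5 := mfderiv_comp y h3 hτ
    rw [mfderiv_eq_fderiv] at h5
    exact this.trans h5
  have hp : φ.symm y = ψ.symm ((ψ ∘ φ.symm) y) := (ψ.left_inv hy').symm
  rw [chartGram_eq_gramAt]
  refine (congrArg (fun D ↦ Real.sqrt (gramAt (φ.symm y) D).det) h4).trans
    ((sqrt_det_gramAt_comp _ _ _).trans ?_)
  exact congrArg (fun p ↦ |(fderiv ℝ (ψ ∘ φ.symm) y).det| * Real.sqrt (gramAt p
    (mfderiv (𝓡 n) (𝓡 n) ψ.symm ((ψ ∘ φ.symm) y) : 𝔼 →L[ℝ] 𝔼)).det) hp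

/-- The coordinate fields are continuous sections because the tangent map of the inverse chart is
continuous; the metric pairs them continuously. -/
theorem continuousOn_chartGram [IsContinuousRiemannianBundle 𝔼 (fun x : M ↦ TangentSpace (𝓡 n) x)]
    (c : M) : ContinuousOn (chartGram (chartAt 𝔼 c)) (chartAt 𝔼 c).target := by
  set φ := chartAt 𝔼 c
  have hsm : ContMDiffOn (𝓡 n) (𝓡 n) 1 φ.symm φ.target := contMDiffOn_chart_symm
  have htan := hsm.continuousOn_tangentMapWithin le_rfl φ.open_target.uniqueMDiffOn
  have hcont : ∀ i : Fin n, ContinuousOn (fun y : 𝔼 ↦ (⟨φ.symm y, mfderiv (𝓡 n) (𝓡 n) φ.symm y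
      (EuclideanSpace.single i (1 : ℝ) : 𝔼)⟩ : TangentBundle (𝓡 n) M)) φ.target := fun i ↦ by
    have h1 : Continuous (fun y : 𝔼 ↦ (⟨y, (EuclideanSpace.single i (1 : ℝ) : 𝔼)⟩ :
        TangentBundle (𝓡 n) 𝔼)) := by
      have := (tangentBundleModelSpaceHomeomorph (𝓡 n)).symm.continuous.comp
        (Continuous.prodMk_left (X := 𝔼) (EuclideanSpace.single i (1 : ℝ) : 𝔼))
      exact this
    have h2 := htan.comp h1.continuousOn (fun y hy ↦ hy)
    refine h2.congr fun y hy ↦ ?_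
    simp only [Function.comp_apply, tangentMapWithin]
    rw [mfderivWithin_of_mem_nhds (φ.open_target.mem_nhds hy)]
  refine continuousOn_pi.2 fun i ↦ continuousOn_pi.2 fun j ↦ ?_
  exact (hcont i).inner_bundle (hcont j)

theorem exists_density_bounds [IsContinuousRiemannianBundle 𝔼 (fun x : M ↦ TangentSpace (𝓡 n) x)]
    (c : M) {U : Set M} (hU : U ∈ 𝓝 c) : ∃ r > 0, ∃ a b : ℝ, 0 < a ∧
      Metric.ball (chartAt 𝔼 c c) r ⊆ (chartAt 𝔼 c).target ∩ (chartAt 𝔼 c).symm ⁻¹' U ∧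
      ∀ y ∈ Metric.ball (chartAt 𝔼 c c) r, a ≤ Real.sqrt (chartGram (chartAt 𝔼 c) y).det ∧
        Real.sqrt (chartGram (chartAt 𝔼 c) y).det ≤ b := by
  set φ := chartAt 𝔼 c
  have hc : φ c ∈ φ.target := mem_chart_target _ c
  have hcont : ContinuousAt (fun y ↦ Real.sqrt (chartGram φ y).det) (φ c) := by
    have : ContinuousAt (chartGram φ) (φ c) :=
      (continuousOn_chartGram c).continuousAt (φ.open_target.mem_nhds hc)
    exact (Real.continuous_sqrt.comp (Continuous.matrix_det continuous_id)).continuousAt.comp this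
  have hpos : 0 < Real.sqrt (chartGram φ (φ c)).det := Real.sqrt_pos.2 (det_chartGram_pos c hc)
  have h1 : ∀ᶠ y in 𝓝 (φ c), y ∈ φ.target ∩ φ.symm ⁻¹' U := by
    refine Filter.inter_mem (φ.open_target.mem_nhds hc) ?_
    refine (φ.symm.continuousAt hc).preimage_mem_nhds ?_
    rwa [φ.left_inv (mem_chart_source _ c)]
  obtain ⟨r, hr, h⟩ := Metric.mem_nhds_iff.1 (Filter.inter_mem h1
    (hcont.preimage_mem_nhds (Ioo_mem_nhds (half_lt_self hpos) (lt_add_one _))))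
  exact ⟨r, hr, _, _, half_pos hpos, h.trans inter_subset_left, fun y hy ↦
    ⟨(h hy).2.1.le, (h hy).2.2.le⟩⟩

/-! ### Comparison of chart measures -/

section Volume

variable [MeasurableSpace M] [BorelSpace M]

theorem measurableSet_target_inter_preimage (φ : OpenPartialHomeomorph M 𝔼) {A : Set M}
    (hA : MeasurableSet A) : MeasurableSet (φ.symm ⁻¹' A ∩ φ.target) := by
  have h1 : Measurable (φ.target.domRestrict φ.symm) :=
    (continuousOn_iff_continuous_domRestrict.1 φ.symm.continuousOn).measurable
  have := (φ.open_target.measurableSet).subtype_image (h1 hA)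
  convert this using 1
  ext y
  simp only [mem_inter_iff, mem_preimage, mem_image, Subtype.exists, exists_and_right,
    exists_eq_right]
  exact ⟨fun h ↦ ⟨h.2, h.1⟩, fun ⟨h, h'⟩ ↦ ⟨h', h⟩⟩

theorem chartVolume_apply (φ : OpenPartialHomeomorph M 𝔼) {A : Set M} (hA : MeasurableSet A) :
    chartVolume φ A = ∫⁻ y in φ.symm ⁻¹' A ∩ φ.target,
      ENNReal.ofReal (Real.sqrt (chartGram φ y).det) := by
  have hm : AEMeasurable φ.symm (volume.restrict φ.target) :=
    φ.symm.continuousOn.aemeasurable φ.open_target.measurableSet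
  rw [chartVolume, Measure.map_apply_of_aemeasurable
    (hm.mono_ac (withDensity_absolutelyContinuous _ _)) hA, withDensity_apply',
    Measure.restrict_restrict' φ.open_target.measurableSet]

/-- Change of variables along the transition map. Only an inequality holds, since `d` gives no mass
to the part of `A` outside its own chart domain. -/
theorem chartVolume_le_of_subset (c d : M) {A : Set M} (hA : MeasurableSet A)
    (hsub : A ⊆ (chartAt 𝔼 c).source) :
    chartVolume (chartAt 𝔼 d) A ≤ chartVolume (chartAt 𝔼 c) A := by
  set φ := chartAt 𝔼 c
  set ψ := chartAt 𝔼 d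
  rw [chartVolume_apply _ hA, chartVolume_apply _ hA]
  set B := φ.symm ⁻¹' (A ∩ ψ.source) ∩ φ.target with hB
  have hBm : MeasurableSet B :=
    measurableSet_target_inter_preimage φ (hA.inter ψ.open_source.measurableSet)
  have himage : ψ.symm ⁻¹' A ∩ ψ.target = (ψ ∘ φ.symm) '' B := by
    ext z
    constructor
    · rintro ⟨hz, hzt⟩
      refine ⟨φ (ψ.symm z), ⟨?_, φ.map_source (hsub hz)⟩, ?_⟩
      · rw [mem_preimage, φ.left_inv (hsub hz)]
        exact ⟨hz, ψ.map_target hzt⟩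
      · simp only [Function.comp_apply]
        rw [φ.left_inv (hsub hz), ψ.right_inv hzt]
    · rintro ⟨y, ⟨hy, hyt⟩, rfl⟩
      refine ⟨?_, ψ.map_source hy.2⟩
      simp only [Function.comp_apply, mem_preimage]
      rw [ψ.left_inv hy.2]
      exact hy.1
  have hinj : InjOn (ψ ∘ φ.symm) B := fun y hy z hz h ↦ by
    have := ψ.injOn hy.1.2 hz.1.2 h
    exact φ.symm.injOn hy.2 hz.2 this
  rw [himage, lintegral_image_eq_lintegral_abs_det_fderiv_mul volume hBm
    (fun y hy ↦ (chartGram_change c d hy.2 hy.1.2).1.hasFDerivWithinAt) hinj]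
  have hcongr : ∫⁻ y in B, ENNReal.ofReal |(fderiv ℝ (ψ ∘ φ.symm) y).det| *
      ENNReal.ofReal (Real.sqrt (chartGram ψ ((ψ ∘ φ.symm) y)).det) =
      ∫⁻ y in B, ENNReal.ofReal (Real.sqrt (chartGram φ y).det) := by
    refine setLIntegral_congr_fun hBm fun y hy ↦ ?_
    rw [← ENNReal.ofReal_mul (abs_nonneg _), (chartGram_change c d hy.2 hy.1.2).2]
    rfl
  rw [hcongr]
  exact lintegral_mono_set (inter_subset_inter_left _ (preimage_mono inter_subset_left))

/-- The supremum of measures is bounded through a common upper bound: the volume of `c` on its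
domain, and the trivial infinite measure elsewhere. On the domain of `c` this bounds the volume by
that of the single chart. -/
theorem riemannianVolume_le (c : M) :
    riemannianVolume n M ≤ chartVolume (chartAt 𝔼 c) +
      ((∞ : ℝ≥0∞) • Measure.count).restrict (chartAt 𝔼 c).sourceᶜ := by
  refine iSup_le fun d ↦ Measure.le_iff.2 fun A hA ↦ ?_
  have hS : MeasurableSet (chartAt 𝔼 c).source := (chartAt 𝔼 c).open_source.measurableSet
  rw [Measure.add_apply, Measure.restrict_apply hA, ← measure_inter_add_sdiff A hS]
  refine add_le_add ((chartVolume_le_of_subset c d (hA.inter hS) inter_subset_right).trans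
    (measure_mono inter_subset_left)) ?_
  rw [sdiff_eq]
  rcases (A ∩ (chartAt 𝔼 c).sourceᶜ).eq_empty_or_nonempty with h | h
  · simp [h]
  · have : Measure.count (A ∩ (chartAt 𝔼 c).sourceᶜ) ≠ 0 := by
      rw [Ne, Measure.count_eq_zero_iff]
      exact h.ne_empty
    rw [Measure.smul_apply, smul_eq_mul, ENNReal.top_mul this]
    exact le_top

variable [IsContinuousRiemannianBundle (EuclideanSpace ℝ (Fin n))
  (fun x : M ↦ TangentSpace (𝓡 n) x)]

instance isLocallyFiniteMeasure_riemannianVolume :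
    IsLocallyFiniteMeasure (riemannianVolume n M) := by
  refine ⟨fun c ↦ ?_⟩
  set φ := chartAt 𝔼 c with hφ
  obtain ⟨r, hr, a, b, -, hsub, hbd⟩ := exists_density_bounds (n := n) c (Filter.univ_mem)
  have hopen : IsOpen (φ.source ∩ φ ⁻¹' Metric.ball (φ c) r) :=
    φ.isOpen_inter_preimage Metric.isOpen_ball
  refine ⟨φ.source ∩ φ ⁻¹' Metric.ball (φ c) r, hopen.mem_nhds
    ⟨mem_chart_source _ c, Metric.mem_ball_self hr⟩, ?_⟩
  refine ((riemannianVolume_le c) _).trans_lt ?_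
  rw [Measure.add_apply, Measure.restrict_apply hopen.measurableSet]
  have h0 : φ.source ∩ φ ⁻¹' Metric.ball (φ c) r ∩ φ.sourceᶜ = ∅ := by
    ext p; simp only [mem_inter_iff, mem_compl_iff, mem_empty_iff_false, iff_false]; tauto
  rw [h0, measure_empty, add_zero, chartVolume_apply _ hopen.measurableSet]
  have hincl : φ.symm ⁻¹' (φ.source ∩ φ ⁻¹' Metric.ball (φ c) r) ∩ φ.target ⊆
      Metric.ball (φ c) r := by
    rintro y ⟨⟨-, hy⟩, hyt⟩
    rwa [mem_preimage, φ.right_inv hyt] at hy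
  calc _ ≤ ∫⁻ y in Metric.ball (φ c) r, ENNReal.ofReal (Real.sqrt (chartGram φ y).det) :=
        lintegral_mono_set hincl
    _ ≤ ∫⁻ y in Metric.ball (φ c) r, ENNReal.ofReal b :=
        setLIntegral_mono' measurableSet_ball fun y hy ↦ ENNReal.ofReal_le_ofReal (hbd y hy).2
    _ < ⊤ := by
        rw [setLIntegral_const]
        exact ENNReal.mul_lt_top ENNReal.ofReal_lt_top measure_ball_lt_top

instance isOpenPosMeasure_riemannianVolume :
    Measure.IsOpenPosMeasure (riemannianVolume n M) := by
  refine ⟨fun U hU ⟨c, hc⟩ ↦ (?_ : 0 < riemannianVolume n M U).ne'⟩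
  set φ := chartAt 𝔼 c with hφ
  obtain ⟨r, hr, a, b, ha, hsub, hbd⟩ := exists_density_bounds (n := n) c (hU.mem_nhds hc)
  have hle : chartVolume φ ≤ riemannianVolume n M :=
    le_iSup (fun x : M ↦ chartVolume (chartAt 𝔼 x)) c
  refine lt_of_lt_of_le ?_ (hle U)
  rw [chartVolume_apply _ hU.measurableSet]
  calc (0 : ℝ≥0∞) < ENNReal.ofReal a * volume (Metric.ball (φ c) r) :=
        ENNReal.mul_pos (ENNReal.ofReal_pos.2 ha).ne' (Metric.measure_ball_pos _ _ hr).ne'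
    _ = ∫⁻ y in Metric.ball (φ c) r, ENNReal.ofReal a := (setLIntegral_const _ _).symm
    _ ≤ ∫⁻ y in Metric.ball (φ c) r, ENNReal.ofReal (Real.sqrt (chartGram φ y).det) :=
        setLIntegral_mono' measurableSet_ball fun y hy ↦ ENNReal.ofReal_le_ofReal (hbd y hy).1
    _ ≤ _ := lintegral_mono_set (μ := volume) (inter_comm (chartAt 𝔼 c).target _ ▸ hsub)

end Volume

end

/-! ### Doubling spaces and discretizations -/

section MetricMeasure

variable {Y : Type*} [MetricSpace Y] [MeasurableSpace Y] [BorelSpace Y] {μ : Measure Y}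

theorem LocalDoubling.exists_measure_ball_le (hD : LocalDoubling μ) {r : ℝ} (hr : 0 < r) (R : ℝ) :
    ∃ C : ℝ≥0, ∀ x, μ (Metric.ball x R) ≤ C * μ (Metric.ball x r) := by
  have key : ∀ k : ℕ, ∃ C : ℝ≥0, ∀ x, μ (Metric.ball x (2 ^ k * r)) ≤ C * μ (Metric.ball x r) := by
    intro k
    induction k with
    | zero => exact ⟨1, fun x ↦ by simp⟩
    | succ k ih =>
      obtain ⟨C, hC⟩ := ih
      obtain ⟨C', hC'⟩ := hD (2 ^ k * r) (by positivity)
      refine ⟨C' * C, fun x ↦ ?_⟩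
      rw [pow_succ', mul_assoc]
      refine (hC' x).trans ?_
      push_cast
      rw [mul_assoc]
      gcongr
      exact hC x
  obtain ⟨k, hk⟩ := pow_unbounded_of_one_lt (R / r) (one_lt_two)
  obtain ⟨C, hC⟩ := key k
  refine ⟨C, fun x ↦ (measure_mono (Metric.ball_subset_ball ?_)).trans (hC x)⟩
  rw [div_lt_iff₀ hr] at hk
  exact hk.le

theorem LocalDoubling.measure_ball_lt_top [IsLocallyFiniteMeasure μ] (hD : LocalDoubling μ)
    (x : Y) (R : ℝ) : μ (Metric.ball x R) < ⊤ := by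
  obtain ⟨s, hs, hμ⟩ := μ.finiteAt_nhds x
  obtain ⟨r, hr, hrs⟩ := Metric.mem_nhds_iff.1 hs
  obtain ⟨C, hC⟩ := hD.exists_measure_ball_le hr R
  exact (hC x).trans_lt (ENNReal.mul_lt_top ENNReal.coe_lt_top ((measure_mono hrs).trans_lt hμ))

variable [IsLocallyFiniteMeasure μ] [μ.IsOpenPosMeasure]

/-- Packing: the balls `B(x, η/2)` are disjoint inside `B(m, R + η)`, and by doubling each carries a
fixed fraction of its measure, as `B(m, R + η) ⊆ B(x, 2R + η)`. -/
theorem LocalDoubling.exists_card_le (hD : LocalDoubling μ) {η : ℝ} (hη : 0 < η) (R : ℝ) :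
    ∃ N : ℕ, ∀ (m : Y) (F : Finset Y), (∀ x ∈ F, dist x m < R) →
      (F : Set Y).Pairwise (fun x y ↦ η ≤ dist x y) → F.card ≤ N := by
  obtain ⟨C, hC⟩ := hD.exists_measure_ball_le (half_pos hη) (2 * R + η)
  refine ⟨⌈C⌉₊, fun m F hF hsep ↦ ?_⟩
  rcases F.eq_empty_or_nonempty with rfl | ⟨x₁, hx₁⟩
  · simp
  have hR : 0 < R := dist_nonneg.trans_lt (hF x₁ hx₁)
  set V := μ (Metric.ball m (R + η)) with hV
  have hV0 : V ≠ 0 := (Metric.measure_ball_pos μ m (by positivity)).ne'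
  have hVt : V ≠ ⊤ := (hD.measure_ball_lt_top m _).ne
  have h1 : ∀ x ∈ F, V ≤ C * μ (Metric.ball x (η / 2)) := fun x hx ↦ by
    refine (measure_mono fun y hy ↦ ?_).trans (hC x)
    rw [Metric.mem_ball] at hy ⊢
    linarith [dist_triangle_right y x m, hF x hx]
  have h2 : ∑ x ∈ F, μ (Metric.ball x (η / 2)) ≤ V := by
    rw [← measure_biUnion_finset]
    · refine measure_mono (iUnion₂_subset fun x hx y hy ↦ ?_)
      rw [Metric.mem_ball] at hy ⊢
      linarith [dist_triangle y x m, hF x hx]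
    · intro x hx y hy hxy
      refine Metric.ball_disjoint_ball ?_
      rw [add_halves]
      exact hsep hx hy hxy
    · exact fun x _ ↦ measurableSet_ball
  have h3 : (F.card : ℝ≥0∞) * V ≤ C * V := by
    calc (F.card : ℝ≥0∞) * V = ∑ x ∈ F, V := by simp
      _ ≤ ∑ x ∈ F, C * μ (Metric.ball x (η / 2)) := Finset.sum_le_sum h1
      _ = C * ∑ x ∈ F, μ (Metric.ball x (η / 2)) := (Finset.mul_sum _ _ _).symm
      _ ≤ C * V := by gcongr
  rw [ENNReal.mul_le_mul_iff_left hV0 hVt] at h3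
  have h4 : (F.card : ℝ≥0) ≤ C := by exact_mod_cast h3
  exact_mod_cast h4.trans (Nat.le_ceil C)

theorem LocalDoubling.totallyBounded_ball (hD : LocalDoubling μ) (m : Y) (R : ℝ) :
    TotallyBounded (Metric.ball m R) := by
  rw [Metric.totallyBounded_iff]
  intro η hη
  by_contra! hno
  have : Std.Symm (fun x y : Y ↦ η ≤ dist x y) := ⟨fun x y h ↦ by rwa [dist_comm]⟩
  obtain ⟨f, hf, hsep⟩ := exists_seq_of_forall_finset_exists' (fun x ↦ dist x m < R)
    (fun x y : Y ↦ η ≤ dist x y) (fun s hs ↦ by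
      obtain ⟨y, hy, hy'⟩ := not_subset.1 (hno s s.finite_toSet)
      refine ⟨y, hy, fun x hx ↦ ?_⟩
      simp only [mem_iUnion, not_exists, Metric.mem_ball, not_lt] at hy'
      rw [dist_comm]
      exact hy' x hx)
  obtain ⟨N, hN⟩ := hD.exists_card_le hη R
  have hinj : Function.Injective f := fun i j hij ↦ by
    by_contra hne
    have h1 : η ≤ dist (f i) (f j) := hsep hne
    rw [hij, dist_self] at h1
    linarith
  classical
  have := hN m ((Finset.range (N + 1)).image f) (fun x hx ↦ by
      obtain ⟨i, -, rfl⟩ := Finset.mem_image.1 hx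
      exact hf i) (fun x hx y hy hxy ↦ by
      obtain ⟨i, -, rfl⟩ := Finset.mem_image.1 (Finset.mem_coe.1 hx)
      obtain ⟨j, -, rfl⟩ := Finset.mem_image.1 (Finset.mem_coe.1 hy)
      exact hsep fun h ↦ hxy (congrArg f h))
  rw [Finset.card_image_of_injective _ hinj, Finset.card_range] at this
  omega

/-- Packing makes balls totally bounded, so completeness gives compact closed balls; no Hopf–Rinow
argument is needed. -/
theorem LocalDoubling.properSpace [CompleteSpace Y] (hD : LocalDoubling μ) : ProperSpace Y := by
  refine ⟨fun x r ↦ isCompact_iff_totallyBounded_isComplete.2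
    ⟨?_, Metric.isClosed_closedBall.isComplete⟩⟩
  exact (hD.totallyBounded_ball x (r + 1)).subset (Metric.closedBall_subset_ball (by linarith))

end MetricMeasure

/-! ### Rough isometry between the graph and the space -/

section Discretization

variable {Y : Type*} [MetricSpace Y] {ε : ℝ} {X : Set Y}

theorem IsDiscretization.exists_dist_lt (hX : IsDiscretization ε X) (hε : 0 < ε) (y : Y) :
    ∃ x : X, dist y x < ε := by
  by_contra! h
  have hy : y ∉ X := fun hy ↦ by
    have := h ⟨y, hy⟩
    simp only [dist_self] at this
    linarith
  have hins : (insert y X).Pairwise fun x z ↦ ε ≤ dist x z := by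
    have : Std.Symm (fun x z : Y ↦ ε ≤ dist x z) := ⟨fun a b hab ↦ by rwa [dist_comm]⟩
    exact (pairwise_insert_of_symm_of_notMem hy).2 ⟨hX.prop, fun z hz ↦ h ⟨z, hz⟩⟩
  exact hy (hX.le_of_ge hins (subset_insert y X) (mem_insert y X))

variable [MeasurableSpace Y] [BorelSpace Y] {μ : Measure Y} [IsLocallyFiniteMeasure μ]
  [μ.IsOpenPosMeasure]

theorem IsDiscretization.exists_finset (hX : IsDiscretization ε X) (hε : 0 < ε)
    (hD : LocalDoubling μ) (R : ℝ) :
    ∃ N : ℕ, ∀ m : Y, ∃ S : Finset X, (∀ x : X, x ∈ S ↔ dist (x : Y) m < R) ∧ S.card ≤ N := by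
  obtain ⟨N, hN⟩ := hD.exists_card_le hε R
  refine ⟨N, fun m ↦ ?_⟩
  have hbd : ∀ S : Finset X, (∀ x ∈ S, dist (x : Y) m < R) → S.card ≤ N := fun S hS ↦ by
    have := hN m (S.map (Function.Embedding.subtype _)) (fun x hx ↦ by
      obtain ⟨z, hz, rfl⟩ := Finset.mem_map.1 hx
      exact hS z hz) (fun x hx y hy hxy ↦ by
      obtain ⟨z, hz, rfl⟩ := Finset.mem_map.1 (Finset.mem_coe.1 hx)
      obtain ⟨w, hw, rfl⟩ := Finset.mem_map.1 (Finset.mem_coe.1 hy)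
      exact hX.prop z.2 w.2 hxy)
    rwa [Finset.card_map] at this
  have hfin : {x : X | dist (x : Y) m < R}.Finite := by
    by_contra hinf
    obtain ⟨S, hS, hcard⟩ := Set.Infinite.exists_subset_card_eq hinf (N + 1)
    have := hbd S fun x hx ↦ hS hx
    omega
  exact ⟨hfin.toFinset, fun x ↦ by simp, hbd _ fun x hx ↦ by simpa using hx⟩

/-- In a locally doubling space with connected balls, points of a discretization that are close
have bounded combinatorial distance. -/
theorem IsDiscretization.exists_edist_le (hX : IsDiscretization ε X) (hε : 0 < ε)
    (hD : LocalDoubling μ) (hconn : ∀ (p : Y) (r : ℝ), IsPreconnected (Metric.ball p r)) (R : ℝ) :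
    ∃ N : ℕ, ∀ (p : Y) (x y : X), dist (x : Y) p < R → dist (y : Y) p < R →
      (discretizationGraph ε X).edist x y ≤ N := by
  obtain ⟨N, hN⟩ := hX.exists_finset hε hD (R + ε)
  refine ⟨N, fun p x y hx hy ↦ ?_⟩
  obtain ⟨F, hF, hcard⟩ := hN p
  set G := discretizationGraph ε X
  let H := G.induce (F : Set X)
  have hxF : x ∈ (F : Set X) := by rw [Finset.mem_coe, hF]; linarith
  have hyF : y ∈ (F : Set X) := by rw [Finset.mem_coe, hF]; linarith
  have hreach : H.Reachable ⟨x, hxF⟩ ⟨y, hyF⟩ := by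
    by_contra hnot
    -- If `y` were unreachable, the `ε`-balls around reachable and unreachable vertices would be two
    -- open sets covering the connected ball `B(p, R)`. A common point makes two of their centres
    -- closer than `2ε`, hence adjacent or equal.
    let O₁ : Set Y := ⋃ z ∈ {z : (F : Set X) | H.Reachable ⟨x, hxF⟩ z}, Metric.ball ((z : X) : Y) ε
    let O₂ : Set Y := ⋃ z ∈ {z : (F : Set X) | ¬ H.Reachable ⟨x, hxF⟩ z},
      Metric.ball ((z : X) : Y) ε
    have hcov : Metric.ball p R ⊆ O₁ ∪ O₂ := fun b hb ↦ by
      obtain ⟨z, hz⟩ := hX.exists_dist_lt hε b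
      have hzF : z ∈ (F : Set X) := by
        rw [Metric.mem_ball] at hb
        rw [Finset.mem_coe, hF]
        linarith [dist_triangle_left (z : Y) p b]
      by_cases h : H.Reachable ⟨x, hxF⟩ ⟨z, hzF⟩
      · exact Or.inl (mem_iUnion₂.2 ⟨⟨z, hzF⟩, h, hz⟩)
      · exact Or.inr (mem_iUnion₂.2 ⟨⟨z, hzF⟩, h, hz⟩)
    obtain ⟨b, hb, hb₁, hb₂⟩ := hconn p R O₁ O₂ (isOpen_biUnion fun _ _ ↦ Metric.isOpen_ball)
      (isOpen_biUnion fun _ _ ↦ Metric.isOpen_ball) hcov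
      ⟨x, hx, mem_biUnion (x := ⟨x, hxF⟩) (SimpleGraph.Reachable.refl _) (Metric.mem_ball_self hε)⟩
      ⟨y, hy, mem_biUnion (x := ⟨y, hyF⟩) hnot (Metric.mem_ball_self hε)⟩
    obtain ⟨z, hz, hbz⟩ := mem_iUnion₂.1 hb₁
    obtain ⟨w, hw, hbw⟩ := mem_iUnion₂.1 hb₂
    rw [Metric.mem_ball] at hbz hbw
    refine hw ?_
    by_cases hzw : z = w
    · exact hzw ▸ hz
    · have hadj : H.Adj z w := by
        refine ⟨fun h ↦ hzw (Subtype.ext h), ?_⟩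
        show dist ((z : X) : Y) ((w : X) : Y) < 2 * ε
        linarith [dist_triangle_left ((z : X) : Y) ((w : X) : Y) b]
      exact SimpleGraph.Reachable.trans hz hadj.reachable
  -- A path visits each of the at most `N` vertices at most once, which bounds its length.
  obtain ⟨w, hw⟩ := hreach.exists_isPath
  have hlen := hw.length_lt
  have h1 := SimpleGraph.edist_le (w.map (SimpleGraph.Embedding.induce (F : Set X)).toHom)
  refine h1.trans ?_
  rw [SimpleGraph.Walk.length_map]
  have h2 : Fintype.card (F : Set X) ≤ N := by simpa using hcard
  exact_mod_cast (hlen.le.trans h2)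

/-- Advance by steps of length `ε`, each costing at most `N` edges. Intermediate points need not lie
in `X`, so the induction runs over an arbitrary endpoint `q` with a nearby vertex `y`. -/
theorem IsDiscretization.exists_edist_le_mul (hX : IsDiscretization ε X) (hε : 0 < ε)
    (hD : LocalDoubling μ) (hconn : ∀ (p : Y) (r : ℝ), IsPreconnected (Metric.ball p r))
    (hlen : ∀ (p q : Y) (r s : ℝ), 0 < r → 0 < s → dist p q < r + s →
      ∃ z, dist p z < r ∧ dist z q < s) :
    ∃ N : ℕ, ∀ (k : ℕ) (x y : X), dist (x : Y) y < (k + 1) * ε →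
      (discretizationGraph ε X).edist x y ≤ (N * (k + 1) : ℕ) := by
  obtain ⟨N, hN⟩ := hX.exists_edist_le hε hD hconn (2 * ε)
  refine ⟨N, fun k x ↦ ?_⟩
  suffices h : ∀ (q : Y) (y : X), dist (x : Y) q < (k + 1) * ε → dist (y : Y) q < ε →
      (discretizationGraph ε X).edist x y ≤ (N * (k + 1) : ℕ) by
    intro y hxy
    exact h y y hxy (by rw [dist_self]; exact hε)
  induction k with
  | zero =>
    intro q y hq hy
    simp only [CharP.cast_eq_zero, zero_add, one_mul, mul_one] at hq ⊢
    exact hN q x y (by linarith) (by linarith)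
  | succ k ih =>
    intro q y hq hy
    obtain ⟨z, hz, hzq⟩ :=
      hlen x q ((k + 1) * ε) ε (by positivity) hε (by push_cast at hq; linarith)
    obtain ⟨w, hw⟩ := hX.exists_dist_lt hε z
    have h1 := ih z w hz (by rwa [dist_comm])
    have h2 := hN z w y (by rw [dist_comm]; linarith)
      (by linarith [dist_triangle_right (y : Y) z q])
    refine SimpleGraph.edist_triangle.trans ((add_le_add h1 h2).trans (le_of_eq ?_))
    push_cast
    ring

theorem IsDiscretization.exists_mem_graphBall (hX : IsDiscretization ε X) (hε : 0 < ε)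
    (hD : LocalDoubling μ) (hconn : ∀ (p : Y) (r : ℝ), IsPreconnected (Metric.ball p r))
    (hlen : ∀ (p q : Y) (r s : ℝ), 0 < r → 0 < s → dist p q < r + s →
      ∃ z, dist p z < r ∧ dist z q < s) :
    ∃ a b : ℝ, 0 < a ∧ 0 < b ∧ ∀ (x₀ x : X) (D : ℝ), 0 < D → dist (x₀ : Y) x < D →
      x ∈ graphBall (discretizationGraph ε X) x₀ (a * D + b) := by
  obtain ⟨N, hN⟩ := hX.exists_edist_le_mul hε hD hconn hlen
  -- `N + 1` instead of `N` makes the bound strict, as the open graph ball requires, even when `N =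
  -- 0`.
  refine ⟨(N + 1) / ε, N + 1, by positivity, by positivity, fun x₀ x D hD0 hx ↦ ?_⟩
  have h1 := hN ⌊D / ε⌋₊ x₀ x (hx.trans ((div_lt_iff₀ hε).1 (Nat.lt_floor_add_one _)))
  have h2 : ((discretizationGraph ε X).edist x₀ x : ℝ≥0∞) ≤ ((N * (⌊D / ε⌋₊ + 1) : ℕ) : ℝ≥0∞) := by
    exact_mod_cast h1
  refine lt_of_le_of_lt h2 ?_
  rw [← ENNReal.ofReal_natCast, ENNReal.ofReal_lt_ofReal_iff (by positivity)]
  have h3 : (⌊D / ε⌋₊ : ℝ) ≤ D / ε := Nat.floor_le (by positivity)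
  have h4 : (0 : ℝ) ≤ D / ε := by positivity
  push_cast
  calc (N : ℝ) * (⌊D / ε⌋₊ + 1) ≤ N * (D / ε + 1) := by gcongr
    _ < (N + 1) * (D / ε + 1) := by nlinarith
    _ = _ := by ring

theorem dist_le_of_walk {x y : X} (w : (discretizationGraph ε X).Walk x y) :
    dist (x : Y) y ≤ 2 * ε * w.length := by
  induction w with
  | nil => simp
  | cons h w ih =>
    rw [SimpleGraph.Walk.length_cons]
    push_cast
    have := h.2
    linarith [dist_triangle (_ : Y) _ _ |>.trans (add_le_add this.le ih)]

theorem dist_lt_of_mem_graphBall (hε : 0 < ε) {x₀ x : X} {R : ℝ}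
    (hx : x ∈ graphBall (discretizationGraph ε X) x₀ R) : dist (x₀ : Y) x < 2 * ε * R := by
  have hR : 0 < R := by
    by_contra h
    have : ENNReal.ofReal R = 0 := ENNReal.ofReal_of_nonpos (not_lt.1 h)
    rw [graphBall, mem_ofPred_eq, this] at hx
    exact not_lt_bot hx
  have hne : (discretizationGraph ε X).edist x₀ x ≠ ⊤ := fun h ↦ by
    rw [graphBall, mem_ofPred_eq, h] at hx
    simp at hx
  obtain ⟨w, hw⟩ := SimpleGraph.exists_walk_of_edist_ne_top hne
  have h1 : (w.length : ℝ) < R := by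
    rw [graphBall, mem_ofPred_eq, ← hw] at hx
    have h2 : ENNReal.ofReal (w.length : ℝ) < ENNReal.ofReal R := by
      rw [ENNReal.ofReal_natCast]; exact_mod_cast hx
    exact (ENNReal.ofReal_lt_ofReal_iff hR).1 h2
  exact (dist_le_of_walk w).trans_lt (by gcongr)

end Discretization

/-! ### Means and overlaps -/

theorem isPreconnected_ball (n : ℕ) {M : Type*} [MetricSpace M]
    [ChartedSpace (EuclideanSpace ℝ (Fin n)) M]
    [IsManifold (𝓡 n) ∞ M]
    [RiemannianBundle (fun x : M ↦ TangentSpace (𝓡 n) x)] [IsRiemannianManifold (𝓡 n) M]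
    (p : M) (r : ℝ) : IsPreconnected (Metric.ball p r) := by
  refine isPreconnected_of_forall p fun q hq ↦ ?_
  rw [Metric.mem_ball] at hq
  have hr : 0 < r := dist_nonneg.trans_lt hq
  have h : edist p q < ENNReal.ofReal r := by
    rw [edist_dist, dist_comm]; exact (ENNReal.ofReal_lt_ofReal_iff hr).2 hq
  obtain ⟨γ, rfl, rfl, hγ, hlen⟩ := exists_path_of_edist_lt (n := n) h
  refine ⟨γ '' Icc 0 1, ?_, mem_image_of_mem _ (by simp), mem_image_of_mem _ (by simp),
    isPreconnected_Icc.image _ hγ.continuous.continuousOn⟩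
  rintro _ ⟨t, ht, rfl⟩
  have h1 : edist (γ 0) (γ t) < ENNReal.ofReal r :=
    ((edist_le_pathELength hγ ht.1).trans (pathELength_mono le_rfl ht.2)).trans_lt hlen
  rw [edist_dist, ENNReal.ofReal_lt_ofReal_iff hr] at h1
  rwa [Metric.mem_ball, dist_comm]

/-- A substitute for points on minimizing geodesics: on a path of length `ℓ < r + s`, stop at
distance `ρ` from `p` with `ℓ - s < ρ < r`. At least `ρ` of the length is spent, so less than `s` is
left. -/
theorem exists_dist_lt_dist_lt (n : ℕ) {M : Type*} [MetricSpace M]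
    [ChartedSpace (EuclideanSpace ℝ (Fin n)) M]
    [IsManifold (𝓡 n) ∞ M]
    [RiemannianBundle (fun x : M ↦ TangentSpace (𝓡 n) x)] [IsRiemannianManifold (𝓡 n) M]
    (p q : M) (r s : ℝ) (hr : 0 < r) (hs : 0 < s)
    (h : dist p q < r + s) : ∃ z, dist p z < r ∧ dist z q < s := by
  rcases lt_or_ge (dist p q) r with hpq | hpq
  · exact ⟨q, hpq, by rwa [dist_self]⟩
  have h' : edist p q < ENNReal.ofReal (r + s) := by
    rw [edist_dist]; exact (ENNReal.ofReal_lt_ofReal_iff (by positivity)).2 h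
  obtain ⟨γ, rfl, rfl, hγ, hlen⟩ := exists_path_of_edist_lt (n := n) h'
  set ℓ := (pathELength (𝓡 n) γ 0 1).toReal
  have hℓ : pathELength (𝓡 n) γ 0 1 = ENNReal.ofReal ℓ :=
    (ENNReal.ofReal_toReal (hlen.trans ENNReal.ofReal_lt_top).ne).symm
  rw [hℓ, ENNReal.ofReal_lt_ofReal_iff (by positivity)] at hlen
  obtain ⟨ρ, hρ1, hρ2⟩ := exists_between (max_lt hr (by linarith : ℓ - s < r))
  have hρ0 : 0 < ρ := (le_max_left _ _).trans_lt hρ1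
  have hρs : ℓ - s < ρ := (le_max_right _ _).trans_lt hρ1
  have hcont : ContinuousOn (fun t ↦ dist (γ 0) (γ t)) (Icc 0 1) :=
    (continuous_const.dist hγ.continuous).continuousOn
  obtain ⟨t, ht, hdt⟩ := intermediate_value_Icc zero_le_one hcont
    (show ρ ∈ Icc _ _ by simp only [dist_self]; exact ⟨hρ0.le, by linarith⟩)
  simp only at hdt
  refine ⟨γ t, by rw [hdt]; exact hρ2, ?_⟩
  have h1 := edist_le_pathELength hγ ht.1
  have h2 := edist_le_pathELength hγ ht.2
  have h3 : ENNReal.ofReal ρ + edist (γ t) (γ 1) ≤ ENNReal.ofReal ℓ := by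
    rw [← hℓ, ← pathELength_add ht.1 ht.2, ← hdt, ← edist_dist]
    exact add_le_add h1 h2
  rw [edist_dist, ← ENNReal.ofReal_add hρ0.le dist_nonneg] at h3
  rw [ENNReal.ofReal_le_ofReal_iff ENNReal.toReal_nonneg] at h3
  linarith

/-! ### Replacing means by arbitrary constants -/

section Mean

variable {α : Type*} [MeasurableSpace α] {ν : Measure α} {σ : ℝ}

/-- Jensen's inequality for the normalized measure, in the form of monotonicity of `Lᵖ` norms. -/
theorem enorm_average_sub_rpow_mul_le [IsFiniteMeasure ν] {u : α → ℝ} (hu : Integrable u ν)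
    (hσ : 1 ≤ σ) (c : ℝ) :
    ‖(⨍ x, u x ∂ν) - c‖ₑ ^ σ * ν univ ≤ ∫⁻ x, ‖u x - c‖ₑ ^ σ ∂ν := by
  have hσ0 : 0 < σ := by linarith
  rcases eq_or_ne ν 0 with rfl | hν
  · simp
  have : NeZero ν := ⟨hν⟩
  have hν0 : ν univ ≠ 0 := by simpa using hν
  set P := (ν univ)⁻¹ • ν with hP
  have hPp : IsProbabilityMeasure P := inferInstance
  have huP : Integrable u P := hu.smul_measure (ENNReal.inv_ne_top.2 hν0)
  have h1 : (⨍ x, u x ∂ν) - c = ∫ x, (u x - c) ∂P := by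
    rw [integral_sub huP (integrable_const c)]
    simp [average, hP]
  have h2 : ‖(⨍ x, u x ∂ν) - c‖ₑ ≤ (∫⁻ x, ‖u x - c‖ₑ ^ σ ∂P) ^ (1 / σ) := by
    rw [h1]
    refine (enorm_integral_le_lintegral_enorm _).trans ?_
    have := eLpNorm'_le_eLpNorm'_of_exponent_le zero_lt_one hσ P
      (huP.sub (integrable_const c)).aestronglyMeasurable
    simpa [eLpNorm'] using this
  have h3 : ‖(⨍ x, u x ∂ν) - c‖ₑ ^ σ ≤ ∫⁻ x, ‖u x - c‖ₑ ^ σ ∂P := by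
    refine (ENNReal.rpow_le_rpow h2 hσ0.le).trans (le_of_eq ?_)
    rw [← ENNReal.rpow_mul, one_div, inv_mul_cancel₀ hσ0.ne', ENNReal.rpow_one]
  rw [hP, lintegral_smul_measure, smul_eq_mul] at h3
  calc _ ≤ (ν univ)⁻¹ * (∫⁻ x, ‖u x - c‖ₑ ^ σ ∂ν) * ν univ := by gcongr
    _ = (ν univ)⁻¹ * ν univ * (∫⁻ x, ‖u x - c‖ₑ ^ σ ∂ν) := by ring
    _ = _ := by rw [ENNReal.inv_mul_cancel hν0 (measure_ne_top _ _), one_mul]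

theorem enorm_sub_rpow_le (hσ : 1 ≤ σ) (a b c : ℝ) :
    ‖a - c‖ₑ ^ σ ≤ 2 ^ (σ - 1) * (‖a - b‖ₑ ^ σ + ‖b - c‖ₑ ^ σ) := by
  refine le_trans (ENNReal.rpow_le_rpow ?_ (by linarith))
    (ENNReal.rpow_add_le_mul_rpow_add_rpow _ _ hσ)
  rw [← sub_add_sub_cancel a b c]
  exact enorm_add_le _ _

theorem lintegral_enorm_sub_rpow_le [IsFiniteMeasure ν] {u : α → ℝ} (hσ : 1 ≤ σ) (b c : ℝ) :
    ∫⁻ x, ‖u x - c‖ₑ ^ σ ∂ν ≤ 2 ^ (σ - 1) * (∫⁻ x, ‖u x - b‖ₑ ^ σ ∂ν + ‖b - c‖ₑ ^ σ * ν univ) := by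
  calc _ ≤ ∫⁻ x, 2 ^ (σ - 1) * (‖u x - b‖ₑ ^ σ + ‖b - c‖ₑ ^ σ) ∂ν :=
        lintegral_mono fun x ↦ enorm_sub_rpow_le hσ _ _ _
    _ = _ := by
        rw [lintegral_const_mul' _ _ (ENNReal.rpow_ne_top_of_nonneg (by linarith) (by simp)),
          lintegral_add_right _ measurable_const, lintegral_const]

/-- The mean is an optimal constant up to a factor `2^σ`, so any convenient `c`, for instance a mean
taken on the other side of the discretization, may replace it. -/
theorem lintegral_enorm_sub_average_le [IsFiniteMeasure ν] {u : α → ℝ} (hu : Integrable u ν)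
    (hσ : 1 ≤ σ) (c : ℝ) : ∫⁻ x, ‖u x - ⨍ y, u y ∂ν‖ₑ ^ σ ∂ν ≤
      2 ^ (σ - 1) * 2 * ∫⁻ x, ‖u x - c‖ₑ ^ σ ∂ν := by
  refine (lintegral_enorm_sub_rpow_le hσ c _).trans ?_
  rw [enorm_sub_rev c, mul_assoc, two_mul]
  gcongr
  exact enorm_average_sub_rpow_mul_le hu hσ c

theorem tsum_enorm_sub_weightedMean_le {V : Type*} {w : V → ℝ≥0∞} {f : V → ℝ} (hσ : 1 ≤ σ)
    {A : Set V} (hA : A.Finite) (hw : ∀ x, w x ≠ ⊤) (c : ℝ) :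
    ∑' x : A, ‖f x - weightedMean w f A‖ₑ ^ σ * w x ≤
      2 ^ (σ - 1) * 2 * ∑' x : A, ‖f x - c‖ₑ ^ σ * w x := by
  have : Finite A := hA
  have : Fintype A := Fintype.ofFinite A
  let _ : MeasurableSpace A := ⊤
  -- The weighted sum is an integral against a sum of point masses, which makes this a case of the
  -- continuous statement.
  let ν : Measure A := ∑ x : A, w x • Measure.dirac x
  have hν : IsFiniteMeasure ν := by
    refine ⟨?_⟩
    simp only [ν, Measure.coe_finsetSum, Finset.sum_apply, Measure.smul_apply, smul_eq_mul,
      measure_univ, mul_one]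
    exact ENNReal.sum_lt_top.2 fun x _ ↦ (hw x).lt_top
  have hl : ∀ F : A → ℝ≥0∞, ∫⁻ x, F x ∂ν = ∑' x : A, F x * w x := fun F ↦ by
    rw [lintegral_finsetSum_measure, tsum_fintype]
    refine Finset.sum_congr rfl fun x _ ↦ ?_
    rw [lintegral_smul_measure, lintegral_dirac, smul_eq_mul, mul_comm]
  have hi : ∀ F : A → ℝ, ∫ x, F x ∂ν = ∑' x : A, (w x).toReal * F x := fun F ↦ by
    rw [integral_finsetSum_measure fun x _ ↦ ?_, tsum_fintype]
    · refine Finset.sum_congr rfl fun x _ ↦ ?_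
      rw [integral_smul_measure, integral_dirac, smul_eq_mul]
    · exact (Integrable.of_finite).smul_measure (hw x)
  have hmean : weightedMean w f A = ⨍ x, f x ∂ν := by
    have h1 : ν.real univ = ∑' x : A, (w x).toReal := by
      have := hi fun _ ↦ 1
      simpa using this
    rw [average_eq, hi, h1, smul_eq_mul]
    rfl
  have := lintegral_enorm_sub_average_le (ν := ν) (u := fun x : A ↦ f x) Integrable.of_finite hσ c
  rwa [hl, hl, ← hmean] at this

end Mean

/-! ### Bounded overlap and double counting -/

section Overlap

variable {Y : Type*} [MetricSpace Y] {ε : ℝ} {X : Set Y} [MeasurableSpace Y] [BorelSpace Y]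
  {μ : Measure Y} [IsLocallyFiniteMeasure μ] [μ.IsOpenPosMeasure]

/-- A point lies in at most `N` of the balls. Stated as an inequality between measures, this applies
to every `h`, measurable or not. -/
theorem IsDiscretization.exists_sum_lintegral_le (hX : IsDiscretization ε X) (hε : 0 < ε)
    (hD : LocalDoubling μ) (ρ : ℝ) : ∃ N : ℕ, ∀ (S : Finset X) (B : Set Y), MeasurableSet B →
      (∀ x ∈ S, Metric.ball (x : Y) ρ ⊆ B) → ∀ h : Y → ℝ≥0∞,
      ∑ x ∈ S, ∫⁻ y in Metric.ball (x : Y) ρ, h y ∂μ ≤ N * ∫⁻ y in B, h y ∂μ := by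
  classical
  obtain ⟨N, hN⟩ := hX.exists_finset hε hD ρ
  refine ⟨N, fun S B hB hS h ↦ ?_⟩
  have hle : ∑ x ∈ S, μ.restrict (Metric.ball (x : Y) ρ) ≤ (N : ℝ≥0∞) • μ.restrict B := by
    refine Measure.le_iff.2 fun A hA ↦ ?_
    rw [Measure.coe_finsetSum, Finset.sum_apply, Measure.smul_apply, smul_eq_mul,
      Measure.restrict_apply hA]
    have h1 : ∀ x ∈ S, μ.restrict (Metric.ball (x : Y) ρ) A =
        ∫⁻ y in A ∩ B, (Metric.ball (x : Y) ρ).indicator 1 y ∂μ := fun x hx ↦ by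
      rw [lintegral_indicator_one measurableSet_ball, Measure.restrict_apply hA,
        Measure.restrict_apply measurableSet_ball]
      congr 1
      ext y
      constructor
      · exact fun hy ↦ ⟨hy.2, hy.1, hS x hx hy.2⟩
      · exact fun hy ↦ ⟨hy.2.1, hy.1⟩
    rw [Finset.sum_congr rfl h1, ← lintegral_finsetSum]
    · calc _ ≤ ∫⁻ y in A ∩ B, (N : ℝ≥0∞) ∂μ := by
            refine lintegral_mono fun y ↦ ?_
            obtain ⟨F, hF, hcard⟩ := hN y
            have h2 : ∀ x ∈ S, (Metric.ball (x : Y) ρ).indicator (1 : Y → ℝ≥0∞) y =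
                if x ∈ F then 1 else 0 := fun x _ ↦ by
              rw [indicator_apply]
              have : y ∈ Metric.ball (x : Y) ρ ↔ x ∈ F := by
                rw [hF, Metric.mem_ball, dist_comm]
              simp only [this, Pi.one_apply]
            simp only
            rw [Finset.sum_congr rfl h2, Finset.sum_ite_mem, Finset.sum_const, nsmul_one]
            exact_mod_cast (Finset.card_le_card Finset.inter_subset_right).trans hcard
        _ = N * μ (A ∩ B) := setLIntegral_const _ _
    · exact fun x _ ↦ measurable_one.indicator measurableSet_ball
  calc ∑ x ∈ S, ∫⁻ y in Metric.ball (x : Y) ρ, h y ∂μ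
      = ∫⁻ y, h y ∂(∑ x ∈ S, μ.restrict (Metric.ball (x : Y) ρ)) :=
        (lintegral_finsetSum_measure _ _ _).symm
    _ ≤ ∫⁻ y, h y ∂((N : ℝ≥0∞) • μ.restrict B) := lintegral_mono' hle le_rfl
    _ = _ := by rw [lintegral_smul_measure, smul_eq_mul]

theorem IsDiscretization.exists_sum_sum_le (hX : IsDiscretization ε X) (hε : 0 < ε)
    (hD : LocalDoubling μ) (ρ : ℝ) : ∃ N : ℕ, ∀ (S S' : Finset X) (T : X → Finset X),
      (∀ x ∈ S, ∀ z ∈ T x, z ∈ S' ∧ dist (z : Y) x < ρ) → ∀ F : X → ℝ≥0∞,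
      ∑ x ∈ S, ∑ z ∈ T x, F z ≤ N * ∑ z ∈ S', F z := by
  classical
  obtain ⟨N, hN⟩ := hX.exists_finset hε hD ρ
  refine ⟨N, fun S S' T hT F ↦ ?_⟩
  rw [Finset.sum_comm' (s' := fun z ↦ S.filter fun x ↦ z ∈ T x) (t' := S')
    (fun x z ↦ ⟨fun h ↦ ⟨Finset.mem_filter.2 ⟨h.1, h.2⟩, (hT x h.1 z h.2).1⟩,
      fun h ↦ Finset.mem_filter.1 h.1⟩), Finset.mul_sum]
  refine Finset.sum_le_sum fun z _ ↦ ?_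
  rw [Finset.sum_const, nsmul_eq_mul]
  gcongr
  obtain ⟨G, hG, hcard⟩ := hN z
  refine le_trans (Finset.card_le_card fun x hx ↦ ?_) hcard
  rw [Finset.mem_filter] at hx
  rw [hG, dist_comm]
  exact (hT x hx.1 z hx.2).2

theorem IsDiscretization.finite_graphBall (hX : IsDiscretization ε X) (hε : 0 < ε)
    (hD : LocalDoubling μ) (x₀ : X) (R : ℝ) :
    (graphBall (discretizationGraph ε X) x₀ R).Finite := by
  obtain ⟨N, hN⟩ := hX.exists_finset hε hD (2 * ε * R)
  obtain ⟨S, hS, -⟩ := hN x₀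
  refine S.finite_toSet.subset fun x hx ↦ ?_
  rw [Finset.mem_coe, hS, dist_comm]
  exact dist_lt_of_mem_graphBall hε hx

end Overlap

theorem tsum_coe_eq_sum_toFinset {V : Type*} {A : Set V} (hA : A.Finite) (F : V → ℝ≥0∞) :
    ∑' x : A, F x = ∑ x ∈ hA.toFinset, F x := by
  have := hA.toFinset.tsum_subtype' F
  rwa [hA.coe_toFinset] at this

/-! ### From the discrete to the continuous inequality on large balls -/

/-- Turns a finite extended constant into a real one; the `+ 1` keeps it positive. -/
theorem ENNReal.le_ofReal_mul_of_le_mul {a Q : ℝ≥0∞} {t : ℝ} (hQ : Q ≠ ⊤)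
    (h : a ≤ Q * ENNReal.ofReal t) : a ≤ ENNReal.ofReal ((Q.toReal + 1) * t) := by
  refine h.trans ?_
  rw [ENNReal.ofReal_mul (by positivity)]
  gcongr
  rw [← ENNReal.ofReal_toReal hQ, ENNReal.toReal_ofReal ENNReal.toReal_nonneg]
  exact ENNReal.ofReal_le_ofReal (by linarith)

theorem setLIntegral_le_sum_of_subset {Y ι : Type*} [MeasurableSpace Y] {μ : Measure Y}
    {S : Finset ι}
    {A : Set Y} {B : ι → Set Y} (hAB : A ⊆ ⋃ i ∈ S, B i) (h : Y → ℝ≥0∞) :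
    ∫⁻ y in A, h y ∂μ ≤ ∑ i ∈ S, ∫⁻ y in B i, h y ∂μ := by
  classical
  refine (lintegral_mono_set hAB).trans ?_
  clear hAB
  induction S using Finset.induction_on with
  | empty => simp
  | insert i S hi ih =>
    rw [Finset.set_biUnion_insert, Finset.sum_insert hi]
    exact (lintegral_union_le _ _ _).trans (by gcongr)

theorem setLIntegral_enorm_sub_average_le_of_subset {Y : Type*} [MeasurableSpace Y] {μ : Measure Y}
    {A B : Set Y} (hAB : A ⊆ B) (hA : μ A ≠ ⊤) {u : Y → ℝ} (hu : IntegrableOn u A μ) {σ : ℝ}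
    (hσ : 1 ≤ σ) (c : ℝ) : ∫⁻ x in A, ‖u x - ⨍ y in A, u y ∂μ‖ₑ ^ σ ∂μ ≤
      2 ^ (σ - 1) * 2 * ∫⁻ x in B, ‖u x - c‖ₑ ^ σ ∂μ := by
  have : IsFiniteMeasure (μ.restrict A) := ⟨by simpa using hA.lt_top⟩
  refine (lintegral_enorm_sub_average_le hu hσ c).trans ?_
  gcongr

section

variable {Y : Type*} [MetricSpace Y] {ε : ℝ} {X : Set Y} [MeasurableSpace Y] [BorelSpace Y]
  {μ : Measure Y} [IsLocallyFiniteMeasure μ] [μ.IsOpenPosMeasure] {σ β : ℝ}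

theorem integrableOn_ball_of_continuous [ProperSpace Y] {u : Y → ℝ} (hu : Continuous u) (m : Y)
    (R : ℝ) : IntegrableOn u (Metric.ball m R) μ :=
  (hu.continuousOn.integrableOn_compact (isCompact_closedBall m R)).mono_set
    Metric.ball_subset_closedBall

theorem discreteGradLength_le {V : Type*} {G : SimpleGraph V} {f : V → ℝ} {x : V} {S : Finset V}
    (hS : ∀ y, G.Adj x y → y ∈ S) {N : ℕ} (hN : S.card ≤ N) {t : ℝ≥0∞}
    (ht : ∀ y, G.Adj x y → ‖f y - f x‖ₑ ≤ t) : discreteGradLength G f x ≤ N * t := by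
  have hfin : (G.neighborSet x).Finite := S.finite_toSet.subset fun y hy ↦ hS y hy
  have h1 : ∑' y : G.neighborSet x, ‖f y - f x‖ₑ ^ 2 ≤ (N * t) ^ 2 := by
    rw [tsum_coe_eq_sum_toFinset hfin fun y ↦ ‖f y - f x‖ₑ ^ 2]
    calc ∑ y ∈ hfin.toFinset, ‖f y - f x‖ₑ ^ 2 ≤ ∑ y ∈ hfin.toFinset, t ^ 2 := by
          refine Finset.sum_le_sum fun y hy ↦ ?_
          gcongr
          exact ht y (by simpa using hy)
      _ = (hfin.toFinset.card : ℝ≥0∞) * t ^ 2 := by simp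
      _ ≤ N ^ 2 * t ^ 2 := by
          gcongr
          have hc : hfin.toFinset.card ≤ N :=
            (Finset.card_le_card fun y hy ↦ hS y (by simpa using hy)).trans hN
          exact_mod_cast hc.trans (Nat.le_self_pow two_ne_zero N)
      _ = _ := (mul_pow _ _ _).symm
  calc discreteGradLength G f x ≤ ((N * t) ^ 2) ^ (1 / 2 : ℝ) :=
        ENNReal.rpow_le_rpow h1 (by norm_num)
    _ = N * t := by
        rw [← ENNReal.rpow_natCast, ← ENNReal.rpow_mul]
        norm_num

/-- For `y ∼ x` both `B(x, ε)` and `B(y, ε)` lie in `B(x, 3ε)`, so their means are each compared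
with the mean there by Jensen and the Poincaré inequality. The function `h` stands for `|∇u|^σ`. -/
theorem IsDiscretization.exists_discreteGradLength_le [ProperSpace Y] (hX : IsDiscretization ε X)
    (hε : 0 < ε) (hD : LocalDoubling μ) (hσ : 1 ≤ σ) (K₂ : ℝ≥0) : ∃ K : ℝ≥0∞, K ≠ ⊤ ∧
      ∀ (u : Y → ℝ) (h : Y → ℝ≥0∞), Continuous u →
      (∀ m, ∫⁻ x in Metric.ball m (3 * ε), ‖u x - ⨍ y in Metric.ball m (3 * ε), u y ∂μ‖ₑ ^ σ ∂μ ≤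
        K₂ * ∫⁻ x in Metric.ball m (9 * ε), h x ∂μ) → ∀ x : X,
      discreteGradLength (discretizationGraph ε X)
          (fun z : X ↦ ⨍ y in Metric.ball (z : Y) ε, u y ∂μ) x ^ σ * μ (Metric.ball (x : Y) ε) ≤
        K * ∫⁻ y in Metric.ball (x : Y) (9 * ε), h y ∂μ := by
  have hσ0 : 0 < σ := by linarith
  obtain ⟨N, hN⟩ := hX.exists_finset hε hD (2 * ε)
  obtain ⟨D, hDb⟩ := hD.exists_measure_ball_le hε (3 * ε)
  have h2 : (2 : ℝ≥0∞) ^ (σ - 1) ≠ ⊤ := ENNReal.rpow_ne_top_of_nonneg (by linarith) (by simp)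
  have hNσ : (N : ℝ≥0∞) ^ σ ≠ ⊤ := ENNReal.rpow_ne_top_of_nonneg hσ0.le (by simp)
  refine ⟨(N : ℝ≥0∞) ^ σ * (2 ^ (σ - 1) * (D * K₂ + D * K₂)), by finiteness, ?_⟩
  intro u h hu hP x
  set f : X → ℝ := fun z : X ↦ ⨍ y in Metric.ball (z : Y) ε, u y ∂μ with hf
  set c := ⨍ y in Metric.ball (x : Y) (3 * ε), u y ∂μ
  set H := ∫⁻ y in Metric.ball (x : Y) (9 * ε), h y ∂μ
  set V := μ (Metric.ball (x : Y) ε) with hV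
  have hV0 : V ≠ 0 := (Metric.measure_ball_pos μ _ hε).ne'
  have hVt : V ≠ ⊤ := (hD.measure_ball_lt_top _ _).ne
  have key : ∀ y : X, dist (y : Y) x < 2 * ε → ‖f y - c‖ₑ ^ σ * V ≤ D * K₂ * H := fun y hy ↦ by
    have hfin : IsFiniteMeasure (μ.restrict (Metric.ball (y : Y) ε)) :=
      ⟨by simpa using hD.measure_ball_lt_top (y : Y) ε⟩
    have e1 := enorm_average_sub_rpow_mul_le (integrableOn_ball_of_continuous (μ := μ) hu (y : Y) ε)
      hσ c
    rw [Measure.restrict_apply_univ] at e1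
    have e2 : ∫⁻ z in Metric.ball (y : Y) ε, ‖u z - c‖ₑ ^ σ ∂μ ≤
        ∫⁻ z in Metric.ball (x : Y) (3 * ε), ‖u z - c‖ₑ ^ σ ∂μ :=
      lintegral_mono_set (Metric.ball_subset_ball' (by linarith))
    have e3 : V ≤ D * μ (Metric.ball (y : Y) ε) :=
      (measure_mono (Metric.ball_subset_ball' (by rw [dist_comm]; linarith))).trans (hDb y)
    calc ‖f y - c‖ₑ ^ σ * V ≤ ‖f y - c‖ₑ ^ σ * (D * μ (Metric.ball (y : Y) ε)) := by gcongr
      _ = D * (‖f y - c‖ₑ ^ σ * μ (Metric.ball (y : Y) ε)) := by ring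
      _ ≤ D * (K₂ * H) := mul_le_mul' le_rfl (e1.trans (e2.trans (hP x)))
      _ = _ := by ring
  set Q := 2 ^ (σ - 1) * (D * K₂ * H + D * K₂ * H) with hQ
  have hnb : ∀ y, (discretizationGraph ε X).Adj x y → ‖f y - f x‖ₑ ≤ (Q / V) ^ σ⁻¹ := fun y hy ↦ by
    rw [ENNReal.le_rpow_inv_iff hσ0, ENNReal.le_div_iff_mul_le (Or.inl hV0) (Or.inl hVt)]
    have hyx : dist (y : Y) x < 2 * ε := by rw [dist_comm]; exact hy.2
    calc ‖f y - f x‖ₑ ^ σ * V ≤ 2 ^ (σ - 1) * (‖f y - c‖ₑ ^ σ + ‖c - f x‖ₑ ^ σ) * V := by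
          gcongr
          exact enorm_sub_rpow_le hσ _ _ _
      _ = 2 ^ (σ - 1) * (‖f y - c‖ₑ ^ σ * V + ‖f x - c‖ₑ ^ σ * V) := by
          rw [enorm_sub_rev c]; ring
      _ ≤ Q := mul_le_mul' le_rfl
          (add_le_add (key y hyx) (key x (by rw [dist_self]; positivity)))
  obtain ⟨S, hS, hcard⟩ := hN x
  have hδ := discreteGradLength_le (S := S)
    (fun y hy ↦ (hS y).2 (by rw [dist_comm]; exact hy.2)) hcard hnb
  calc _ ≤ (N * (Q / V) ^ σ⁻¹) ^ σ * V := by gcongr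
    _ = N ^ σ * (Q / V * V) := by
        rw [ENNReal.mul_rpow_of_nonneg _ _ hσ0.le, ENNReal.rpow_inv_rpow hσ0.ne']
        ring
    _ = N ^ σ * Q := by rw [ENNReal.div_mul_cancel hV0 hVt]
    _ = _ := by rw [hQ]; ring

/-- Cover `B(m, R)` by balls `B(x, ε)`, take for `c` the discrete mean of `f` over a graph ball
containing their centres, and sum the local estimates with the discrete inequality. -/
theorem IsDiscretization.exists_poincare_of_discretePoincare [ProperSpace Y]
    (hX : IsDiscretization ε X) (hε : 0 < ε) (hD : LocalDoubling μ)
    (hconn : ∀ (p : Y) (r : ℝ), IsPreconnected (Metric.ball p r))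
    (hlen : ∀ (p q : Y) (r s : ℝ), 0 < r → 0 < s → dist p q < r + s →
      ∃ z, dist p z < r ∧ dist z q < s)
    (hσ : 1 ≤ σ) (hβ : 0 ≤ β) (K₁ K₂ : ℝ≥0)
    (hdis : DiscretePoincare (discretizationGraph ε X) (discretizationWeight μ ε X) σ β) :
    ∃ C : ℝ, 0 < C ∧ ∃ K : ℝ, 0 < K ∧ ∀ (u : Y → ℝ) (h : Y → ℝ≥0∞), Continuous u →
      (∀ m, ∫⁻ x in Metric.ball m ε, ‖u x - ⨍ y in Metric.ball m ε, u y ∂μ‖ₑ ^ σ ∂μ ≤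
        K₁ * ∫⁻ x in Metric.ball m (3 * ε), h x ∂μ) →
      (∀ m, ∫⁻ x in Metric.ball m (3 * ε), ‖u x - ⨍ y in Metric.ball m (3 * ε), u y ∂μ‖ₑ ^ σ ∂μ ≤
        K₂ * ∫⁻ x in Metric.ball m (9 * ε), h x ∂μ) →
      ∀ R, ε ≤ R → ∀ m,
        ∫⁻ x in Metric.ball m R, ‖u x - ⨍ y in Metric.ball m R, u y ∂μ‖ₑ ^ σ ∂μ ≤
          ENNReal.ofReal (K * R ^ β) * ∫⁻ x in Metric.ball m (C * R), h x ∂μ := by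
  obtain ⟨r₁, hr₁, C₀, hC₀, C', hC', hdis⟩ := hdis
  obtain ⟨a, b, ha, hb, hab⟩ := hX.exists_mem_graphBall hε hD hconn hlen
  obtain ⟨N₁, hN₁⟩ := hX.exists_sum_lintegral_le hε hD (3 * ε)
  obtain ⟨N₂, hN₂⟩ := hX.exists_sum_lintegral_le hε hD (9 * ε)
  obtain ⟨K₃, hK₃t, hK₃⟩ := hX.exists_discreteGradLength_le hε hD hσ K₂
  -- Chosen so that, for `R ≥ ε`, the graph ball of radius `A R` contains every vertex within `R +
  -- 2ε` of `x₀`, and `A R ≥ r₁`.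
  set A : ℝ := 3 * a + b / ε + r₁ / ε with hA
  have hA0 : 0 < A := by positivity
  have h2 : (2 : ℝ≥0∞) ^ (σ - 1) ≠ ⊤ := ENNReal.rpow_ne_top_of_nonneg (by linarith) (by simp)
  -- The factor `ε^(-β)` lets the local term, which has no `R^β`, be absorbed, since `R ≥ ε`.
  set Q : ℝ≥0∞ := 2 ^ (σ - 1) * 2 * (2 ^ (σ - 1) * (K₁ * N₁ * ENNReal.ofReal ((ε ^ β)⁻¹) +
    ENNReal.ofReal (C₀ * A ^ β) * K₃ * N₂)) with hQ
  have hQt : Q ≠ ⊤ := by rw [hQ]; finiteness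
  -- The enlarged graph ball has metric radius `2ε C' A R`; the `10` pays for `d(m, x₀) < ε` and for
  -- the radius `9ε`.
  refine ⟨2 * ε * C' * A + 10, by positivity, Q.toReal + 1, by positivity, ?_⟩
  intro u h hu hP₁ hP₂ R hR m
  have hR0 : 0 < R := hε.trans_le hR
  set f : X → ℝ := fun z : X ↦ ⨍ y in Metric.ball (z : Y) ε, u y ∂μ with hf
  obtain ⟨x₀, hx₀⟩ := hX.exists_dist_lt hε m
  have hAR : a * (R + 2 * ε) + b ≤ A * R := by
    have e1 : b ≤ b / ε * R := by rw [div_mul_eq_mul_div, le_div_iff₀ hε]; gcongr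
    have e2 : 0 ≤ r₁ / ε * R := by positivity
    rw [hA]
    nlinarith
  have hr₁R : r₁ ≤ A * R := by
    have e1 : r₁ ≤ r₁ / ε * R := by rw [div_mul_eq_mul_div, le_div_iff₀ hε]; gcongr
    have e2 : 0 ≤ (3 * a + b / ε) * R := by positivity
    rw [hA]
    linarith
  set G := discretizationGraph ε X
  have hw : ∀ x : X, discretizationWeight μ ε X x ≠ ⊤ := fun x ↦ (hD.measure_ball_lt_top _ _).ne
  set c := weightedMean (discretizationWeight μ ε X) f (graphBall G x₀ (A * R)) with hc
  have hdisc := hdis f (A * R) hr₁R x₀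
  rw [← hc] at hdisc
  have hfin := hX.finite_graphBall hε hD x₀ (A * R)
  have hfin' := hX.finite_graphBall hε hD x₀ (C' * (A * R))
  set S := hfin.toFinset with hS
  set S' := hfin'.toFinset with hS'
  rw [tsum_coe_eq_sum_toFinset hfin (fun x ↦ ‖f x - c‖ₑ ^ σ * discretizationWeight μ ε X x),
    tsum_coe_eq_sum_toFinset hfin'
      (fun x ↦ discreteGradLength G f x ^ σ * discretizationWeight μ ε X x)] at hdisc
  set B := Metric.ball m ((2 * ε * C' * A + 10) * R) with hB
  have hSB : ∀ x ∈ S, Metric.ball (x : Y) (3 * ε) ⊆ B := fun x hx ↦ by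
    have hx' := dist_lt_of_mem_graphBall hε (hfin.mem_toFinset.1 hx)
    refine Metric.ball_subset_ball' ?_
    have e1 : dist (x : Y) m ≤ dist (x₀ : Y) x + dist m x₀ := by
      rw [dist_comm (x₀ : Y), dist_comm m]; exact dist_triangle _ _ _
    have e2 : 2 * ε * (A * R) * 1 ≤ 2 * ε * (A * R) * C' := by gcongr
    nlinarith
  have hSB' : ∀ x ∈ S', Metric.ball (x : Y) (9 * ε) ⊆ B := fun x hx ↦ by
    have hx' := dist_lt_of_mem_graphBall hε (hfin'.mem_toFinset.1 hx)
    refine Metric.ball_subset_ball' ?_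
    have e1 : dist (x : Y) m ≤ dist (x₀ : Y) x + dist m x₀ := by
      rw [dist_comm (x₀ : Y), dist_comm m]; exact dist_triangle _ _ _
    nlinarith
  have hcov : Metric.ball m R ⊆ ⋃ x ∈ S, Metric.ball (x : Y) ε := fun y hy ↦ by
    obtain ⟨x, hx⟩ := hX.exists_dist_lt hε y
    refine mem_iUnion₂.2 ⟨x, ?_, hx⟩
    rw [hS, hfin.mem_toFinset]
    rw [Metric.mem_ball] at hy
    have : dist (x₀ : Y) x < R + 2 * ε := by
      have e2 : dist (x₀ : Y) x ≤ dist m x₀ + dist y m + dist y x := by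
        rw [dist_comm m, dist_comm y m]
        exact dist_triangle4 _ _ _ _
      linarith
    have hmem := hab x₀ x _ (by positivity) this
    exact lt_of_lt_of_le hmem (ENNReal.ofReal_le_ofReal hAR)
  -- Split `u - c` as `(u - f x) + (f x - c)`: local Poincaré handles the first term, the discrete
  -- sum the second.
  have hball : ∀ x : X, ∫⁻ y in Metric.ball (x : Y) ε, ‖u y - c‖ₑ ^ σ ∂μ ≤
      2 ^ (σ - 1) * (K₁ * ∫⁻ y in Metric.ball (x : Y) (3 * ε), h y ∂μ +
        ‖f x - c‖ₑ ^ σ * discretizationWeight μ ε X x) := fun x ↦ by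
    have hfm : IsFiniteMeasure (μ.restrict (Metric.ball (x : Y) ε)) :=
      ⟨by simpa using hD.measure_ball_lt_top (x : Y) ε⟩
    refine (lintegral_enorm_sub_rpow_le hσ (f x) c).trans ?_
    rw [Measure.restrict_apply_univ]
    gcongr
    · exact hP₁ x
    · exact le_rfl
  set I := ∫⁻ y in B, h y ∂μ with hI
  have hsum : ∫⁻ y in Metric.ball m R, ‖u y - c‖ₑ ^ σ ∂μ ≤
      2 ^ (σ - 1) * (K₁ * (N₁ * I) + ENNReal.ofReal (C₀ * (A * R) ^ β) * (K₃ * (N₂ * I))) := by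
    refine (setLIntegral_le_sum_of_subset hcov _).trans
      ((Finset.sum_le_sum fun x _ ↦ hball x).trans ?_)
    rw [← Finset.mul_sum, Finset.sum_add_distrib, ← Finset.mul_sum]
    gcongr
    · exact hN₁ S B measurableSet_ball hSB h
    · refine hdisc.trans ?_
      gcongr
      calc _ ≤ ∑ x ∈ S', K₃ * ∫⁻ y in Metric.ball (x : Y) (9 * ε), h y ∂μ :=
            Finset.sum_le_sum fun x _ ↦ hK₃ u h hu hP₂ x
        _ ≤ _ := by
            rw [← Finset.mul_sum]
            gcongr
            exact hN₂ S' B measurableSet_ball hSB' h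
  have hfinal : 2 ^ (σ - 1) * 2 * (2 ^ (σ - 1) *
      (K₁ * N₁ + ENNReal.ofReal (C₀ * (A * R) ^ β) * (K₃ * N₂))) ≤ Q * ENNReal.ofReal (R ^ β) := by
    have e1 : (1 : ℝ≥0∞) ≤ ENNReal.ofReal ((ε ^ β)⁻¹) * ENNReal.ofReal (R ^ β) := by
      rw [← ENNReal.ofReal_mul (by positivity), ENNReal.one_le_ofReal, inv_mul_eq_div,
        one_le_div₀ (by positivity)]
      exact Real.rpow_le_rpow hε.le hR hβ
    have e2 : ENNReal.ofReal (C₀ * (A * R) ^ β) =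
        ENNReal.ofReal (C₀ * A ^ β) * ENNReal.ofReal (R ^ β) := by
      rw [← ENNReal.ofReal_mul (by positivity), Real.mul_rpow hA0.le hR0.le, mul_assoc]
    rw [e2, hQ]
    calc _ ≤ 2 ^ (σ - 1) * 2 * (2 ^ (σ - 1) *
          (K₁ * N₁ * (ENNReal.ofReal ((ε ^ β)⁻¹) * ENNReal.ofReal (R ^ β)) +
          ENNReal.ofReal (C₀ * A ^ β) * ENNReal.ofReal (R ^ β) * (K₃ * N₂))) :=
        mul_le_mul' le_rfl (mul_le_mul' le_rfl (add_le_add (le_mul_of_one_le_right' e1) le_rfl))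
      _ = _ := by ring
  calc _ ≤ 2 ^ (σ - 1) * 2 * ∫⁻ y in Metric.ball m R, ‖u y - c‖ₑ ^ σ ∂μ :=
        setLIntegral_enorm_sub_average_le_of_subset Subset.rfl (hD.measure_ball_lt_top _ _).ne
          (integrableOn_ball_of_continuous hu m R) hσ c
    _ ≤ 2 ^ (σ - 1) * 2 * (2 ^ (σ - 1) *
          (K₁ * (N₁ * I) + ENNReal.ofReal (C₀ * (A * R) ^ β) * (K₃ * (N₂ * I)))) := by gcongr
    _ = 2 ^ (σ - 1) * 2 * (2 ^ (σ - 1) *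
          (K₁ * N₁ + ENNReal.ofReal (C₀ * (A * R) ^ β) * (K₃ * N₂))) * I := by ring
    _ ≤ _ := by
        gcongr
        exact ENNReal.le_ofReal_mul_of_le_mul hQt hfinal

end

/-! ### From the discrete inequality to the inequality on the manifold -/

section

variable {n : ℕ} {M : Type*} [MetricSpace M] [MeasurableSpace M] [BorelSpace M]
  [ChartedSpace (EuclideanSpace ℝ (Fin n)) M] [IsManifold (𝓡 n) ∞ M]
  [RiemannianBundle (fun x : M ↦ TangentSpace (𝓡 n) x)]
  [IsContinuousRiemannianBundle (EuclideanSpace ℝ (Fin n))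
  (fun x : M ↦ TangentSpace (𝓡 n) x)]
  [IsRiemannianManifold (𝓡 n) M] [ProperSpace M] {σ β ε : ℝ}

/-- For `R` below the scale `s = ε / 2^k` with `s ≤ 2R`, compare with the mean over `B(m, s)`; its
energy ball has radius `3s ≤ 6R`. The enlargement 6 is the same for all `k`, as `UniformPoincare`
needs a dilation independent of `r₀`. -/
theorem LocalPoincare.exists_bounded_radii (hP : LocalPoincare n M σ) (hσ : 1 ≤ σ) (hε : 0 < ε)
    (k : ℕ) : ∃ K : ℝ≥0, ∀ u : M → ℝ, ContMDiff (𝓡 n) 𝓘(ℝ, ℝ) 1 u → ∀ R, ε / 2 ^ k ≤ R → R ≤ ε →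
      ∀ m : M,
      ∫⁻ x in Metric.ball m R, ‖u x - ⨍ y in Metric.ball m R, u y ∂(riemannianVolume n M)‖ₑ ^ σ
          ∂(riemannianVolume n M) ≤
        K * ∫⁻ x in Metric.ball m (6 * R), gradLength n u x ^ σ ∂(riemannianVolume n M) := by
  induction k with
  | zero =>
    obtain ⟨K, hK⟩ := hP ε hε
    refine ⟨K, fun u hu R h1 h2 m ↦ ?_⟩
    obtain rfl : R = ε := le_antisymm h2 (by simpa using h1)
    refine (hK u hu m).trans (mul_le_mul' le_rfl (lintegral_mono_set ?_))
    exact Metric.ball_subset_ball (by linarith)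
  | succ k ih =>
    obtain ⟨K₁, hK₁⟩ := ih
    have hs : 0 < ε / 2 ^ k := by positivity
    obtain ⟨K₂, hK₂⟩ := hP _ hs
    have h2 : (2 : ℝ≥0∞) ^ (σ - 1) ≠ ⊤ := ENNReal.rpow_ne_top_of_nonneg (by linarith) (by simp)
    refine ⟨K₁ + ((2 : ℝ≥0∞) ^ (σ - 1) * 2 * K₂).toNNReal, fun u hu R h1 hR m ↦ ?_⟩
    rw [ENNReal.coe_add, ENNReal.coe_toNNReal (by finiteness), add_mul]
    rcases le_or_gt (ε / 2 ^ k) R with h | h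
    · exact (hK₁ u hu R h hR m).trans le_self_add
    · refine le_trans ?_ le_add_self
      have hs2 : ε / 2 ^ k ≤ 2 * R := by
        rw [pow_succ, ← div_div] at h1
        linarith
      have hfin : riemannianVolume n M (Metric.ball m R) ≠ ⊤ :=
        Metric.isBounded_ball.measure_lt_top.ne
      refine (setLIntegral_enorm_sub_average_le_of_subset (Metric.ball_subset_ball h.le) hfin
        (integrableOn_ball_of_continuous hu.continuous m R) hσ
        (⨍ y in Metric.ball m (ε / 2 ^ k), u y ∂(riemannianVolume n M))).trans ?_
      rw [mul_assoc _ (K₂ : ℝ≥0∞)]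
      refine mul_le_mul' le_rfl ((hK₂ u hu m).trans (mul_le_mul' le_rfl (lintegral_mono_set ?_)))
      exact Metric.ball_subset_ball (by linarith)

theorem LocalPoincare.uniformPoincare (hP : LocalPoincare n M σ) (hσ : 1 ≤ σ) (hβ : 0 ≤ β)
    (hε : 0 < ε) {C₀ K₀ : ℝ} (hK₀ : 0 < K₀)
    (h : ∀ u : M → ℝ, ContMDiff (𝓡 n) 𝓘(ℝ, ℝ) 1 u → ∀ R, ε ≤ R → ∀ m : M,
      ∫⁻ x in Metric.ball m R, ‖u x - ⨍ y in Metric.ball m R, u y ∂(riemannianVolume n M)‖ₑ ^ σ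
          ∂(riemannianVolume n M) ≤ ENNReal.ofReal (K₀ * R ^ β) *
        ∫⁻ x in Metric.ball m (C₀ * R), gradLength n u x ^ σ ∂(riemannianVolume n M)) :
    UniformPoincare n M σ β := by
  refine ⟨max 6 C₀, by positivity, fun r₀ hr₀ ↦ ?_⟩
  obtain ⟨k, hk⟩ : ∃ k : ℕ, ε / 2 ^ k ≤ r₀ := by
    obtain ⟨k, hk⟩ := pow_unbounded_of_one_lt (ε / r₀) one_lt_two
    refine ⟨k, ?_⟩
    rw [div_lt_iff₀ hr₀] at hk
    rw [div_le_iff₀ (by positivity)]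
    linarith
  obtain ⟨K₁, hK₁⟩ := hP.exists_bounded_radii hσ hε k
  refine ⟨K₀ + K₁ / r₀ ^ β, by positivity, fun u hu R hR m ↦ ?_⟩
  have hR0 : 0 < R := hr₀.trans_le hR
  rcases le_or_gt ε R with hεR | hεR
  · refine (h u hu R hεR m).trans (mul_le_mul' (ENNReal.ofReal_le_ofReal ?_)
      (lintegral_mono_set (Metric.ball_subset_ball ?_)))
    · have : 0 ≤ K₁ / r₀ ^ β := by positivity
      gcongr
      linarith
    · gcongr
      exact le_max_right _ _
  · refine (hK₁ u hu R (hk.trans hR) hεR.le m).trans (mul_le_mul' ?_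
      (lintegral_mono_set (Metric.ball_subset_ball ?_)))
    · rw [← ENNReal.ofReal_coe_nnreal]
      refine ENNReal.ofReal_le_ofReal ?_
      have h1 : (K₁ : ℝ) ≤ K₁ / r₀ ^ β * R ^ β := by
        rw [div_mul_eq_mul_div, le_div_iff₀ (by positivity)]
        gcongr
      have h2 : 0 ≤ K₀ * R ^ β := by positivity
      linarith
    · gcongr
      exact le_max_left _ _

theorem IsDiscretization.uniformPoincare_of_discretePoincare {X : Set M} (hX : IsDiscretization ε X)
    (hε : 0 < ε) (hD : LocalDoubling (riemannianVolume n M)) (hP : LocalPoincare n M σ) (hσ : 1 ≤ σ)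
    (hβ : 0 ≤ β) (hdis : DiscretePoincare (discretizationGraph ε X)
      (discretizationWeight (riemannianVolume n M) ε X) σ β) : UniformPoincare n M σ β := by
  obtain ⟨K₁, hK₁⟩ := hP ε hε
  obtain ⟨K₂, hK₂⟩ := hP (3 * ε) (by positivity)
  obtain ⟨C, -, K, hK, h⟩ := hX.exists_poincare_of_discretePoincare hε hD (isPreconnected_ball n)
    (exists_dist_lt_dist_lt n) hσ hβ K₁ K₂ hdis
  refine hP.uniformPoincare hσ hβ hε hK fun u hu ↦
    h u (fun x ↦ gradLength n u x ^ σ) hu.continuous (hK₁ u hu) fun m ↦ ?_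
  convert hK₂ u hu m using 5
  ring

end

/-! ### Smooth extension of functions on a discretization -/

/-- A quotient of Lipschitz sums: the weighted mean of bounded coefficients is Lipschitz. -/
theorem lipschitzOnWith_sum_div_sum {Y ι : Type*} [PseudoMetricSpace Y] {S : Finset ι} {U : Set Y}
    {φ : ι → Y → ℝ} {Λ : ℝ≥0} (hφ : ∀ i ∈ S, LipschitzOnWith Λ (φ i) U) (h0 : ∀ i p, 0 ≤ φ i p)
    (h1 : ∀ p ∈ U, 1 ≤ ∑ i ∈ S, φ i p) {a : ι → ℝ} {t : ℝ≥0} (ha : ∀ i ∈ S, |a i| ≤ t) {N : ℕ}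
    (hN : S.card ≤ N) :
    LipschitzOnWith (2 * N * Λ * t) (fun p ↦ (∑ i ∈ S, a i * φ i p) / ∑ i ∈ S, φ i p) U := by
  have hφd : ∀ p ∈ U, ∀ q ∈ U, ∀ i ∈ S, |φ i p - φ i q| ≤ Λ * dist p q := fun p hp q hq i hi ↦ by
    rw [← Real.dist_eq]; exact (hφ i hi).dist_le_mul p hp q hq
  have hle : ∀ p ∈ U, |(∑ i ∈ S, a i * φ i p) / ∑ i ∈ S, φ i p| ≤ t := fun p hp ↦ by
    have hpos : 0 < ∑ i ∈ S, φ i p := zero_lt_one.trans_le (h1 p hp)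
    rw [abs_div, abs_of_pos hpos, div_le_iff₀ hpos, Finset.mul_sum]
    refine (Finset.abs_sum_le_sum_abs _ _).trans (Finset.sum_le_sum fun i hi ↦ ?_)
    rw [abs_mul, abs_of_nonneg (h0 i p)]
    exact mul_le_mul_of_nonneg_right (ha i hi) (h0 i p)
  refine LipschitzOnWith.of_dist_le_mul fun p hp q hq ↦ ?_
  have hpos : 0 < ∑ i ∈ S, φ i p := zero_lt_one.trans_le (h1 p hp)
  have hq0 : ∑ i ∈ S, φ i q ≠ 0 := (zero_lt_one.trans_le (h1 q hq)).ne'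
  have hNr : (S.card : ℝ) ≤ N := by exact_mod_cast hN
  have e1 : |(∑ i ∈ S, a i * φ i p) - ∑ i ∈ S, a i * φ i q| ≤ N * (t * (Λ * dist p q)) := by
    rw [← Finset.sum_sub_distrib]
    refine (Finset.abs_sum_le_sum_abs _ _).trans ((Finset.sum_le_card_nsmul _ _
      (t * (Λ * dist p q)) fun i hi ↦ ?_).trans ?_)
    · rw [← mul_sub, abs_mul]
      exact mul_le_mul (ha i hi) (hφd p hp q hq i hi) (abs_nonneg _) t.2
    · rw [nsmul_eq_mul]
      gcongr
  have e2 : |(∑ i ∈ S, φ i q) - ∑ i ∈ S, φ i p| ≤ N * (Λ * dist p q) := by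
    rw [← Finset.sum_sub_distrib]
    refine (Finset.abs_sum_le_sum_abs _ _).trans ((Finset.sum_le_card_nsmul _ _
      (Λ * dist p q) fun i hi ↦ ?_).trans ?_)
    · rw [abs_sub_comm]
      exact hφd p hp q hq i hi
    · rw [nsmul_eq_mul]
      gcongr
  set v := (∑ i ∈ S, a i * φ i q) / ∑ i ∈ S, φ i q with hv
  -- Quotient rule for differences: the denominator at `p` is at least 1, and `|v| ≤ t` because `v`
  -- is a weighted mean.
  have e3 : (∑ i ∈ S, a i * φ i p) / (∑ i ∈ S, φ i p) - v =
      ((∑ i ∈ S, a i * φ i p) - (∑ i ∈ S, a i * φ i q) + v * ((∑ i ∈ S, φ i q) - ∑ i ∈ S, φ i p)) /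
        ∑ i ∈ S, φ i p := by
    rw [hv]; field_simp; ring
  rw [Real.dist_eq, e3, abs_div, abs_of_pos hpos]
  refine (div_le_self (abs_nonneg _) (h1 p hp)).trans ((abs_add_le _ _).trans ?_)
  rw [abs_mul]
  have e4 : |v| * |(∑ i ∈ S, φ i q) - ∑ i ∈ S, φ i p| ≤ t * (N * (Λ * dist p q)) :=
    mul_le_mul (hle q hq) e2 (abs_nonneg _) t.2
  push_cast
  linarith

section

variable {n : ℕ} {M : Type*} [MetricSpace M]
    [ChartedSpace (EuclideanSpace ℝ (Fin n)) M] [IsManifold (𝓡 n) ∞ M]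
    [RiemannianBundle (fun x : M ↦ TangentSpace (𝓡 n) x)]
  [IsContinuousRiemannianBundle (EuclideanSpace ℝ (Fin n))
  (fun x : M ↦ TangentSpace (𝓡 n) x)]
  [IsRiemannianManifold (𝓡 n) M] [MeasurableSpace M] [BorelSpace M] [ProperSpace M]
  {μ : Measure M} [IsLocallyFiniteMeasure μ] [μ.IsOpenPosMeasure] {ε : ℝ} {X : Set M}

variable (n) in
/-- Functions on a discretization extend to `C¹` functions whose gradient is controlled by the
oscillation of the given function. -/
theorem IsDiscretization.exists_smoothing (hX : IsDiscretization ε X) (hε : 0 < ε)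
    (hD : LocalDoubling μ) : ∃ Λ : ℝ≥0, ∀ f : X → ℝ, ∃ v : M → ℝ, ContMDiff (𝓡 n) 𝓘(ℝ, ℝ) 1 v ∧
      ∀ (x : X) (t : ℝ≥0), (∀ y : X, dist (y : M) x < 4 * ε → |f y - f x| ≤ t) →
        ∀ z ∈ Metric.ball (x : M) ε, |v z - f x| ≤ t ∧ gradLength n v z ≤ Λ * t := by
  obtain ⟨Λ, hΛ⟩ := exists_bump n M hε
  obtain ⟨N, hN⟩ := hX.exists_finset hε hD (3 * ε)
  choose φ hφ hφ0 hφ1 hφin hφout hφlip using hΛ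
  choose S hS hcard using hN
  -- `2 N Λ` is the Lipschitz factor of the quotient; the outer 2 is the loss from Lipschitz
  -- constant to gradient.
  refine ⟨2 * (2 * N * Λ), fun f ↦ ?_⟩
  set v : M → ℝ := fun z ↦ (∑ᶠ y : X, f y * φ y z) / ∑ᶠ y : X, φ y z with hv
  have hsupp : ∀ p, ∀ z ∈ Metric.ball p ε, ∀ y : X, φ y z ≠ 0 → y ∈ S p := fun p z hz y hy ↦ by
    rw [hS]
    have h1 : z ∈ Metric.ball (y : M) (2 * ε) := by
      by_contra h
      exact hy (hφout y z h)
    rw [Metric.mem_ball] at h1 hz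
    linarith [dist_triangle_left (y : M) p z]
  have hsum : ∀ p, ∀ z ∈ Metric.ball p ε,
      v z = (∑ y ∈ S p, f y * φ y z) / ∑ y ∈ S p, φ y z := fun p z hz ↦ by
    simp only [hv]
    congr 1
    · exact finsum_eq_sum_of_support_subset _ fun y hy ↦
        hsupp p z hz y (right_ne_zero_of_mul (Function.mem_support.1 hy))
    · exact finsum_eq_sum_of_support_subset _ fun y hy ↦ hsupp p z hz y (Function.mem_support.1 hy)
  have hge : ∀ p, ∀ z ∈ Metric.ball p ε, 1 ≤ ∑ y ∈ S p, φ y z := fun p z hz ↦ by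
    obtain ⟨y, hy⟩ := hX.exists_dist_lt hε z
    have h1 : φ y z = 1 := hφin y z hy
    rw [← h1]
    exact Finset.single_le_sum (f := fun y : X ↦ φ y z) (fun i _ ↦ hφ0 i z)
      (hsupp p z hz y (by rw [h1]; exact one_ne_zero))
  have hsmooth : ContMDiff (𝓡 n) 𝓘(ℝ, ℝ) 1 v := fun p ↦ by
    have h1 : ContMDiffAt (𝓡 n) 𝓘(ℝ, ℝ) 1
        (fun z ↦ (∑ y ∈ S p, f y * φ y z) / ∑ y ∈ S p, φ y z) p := by
      refine ContMDiffAt.div₀ ?_ ?_ ?_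
      · exact contMDiffAt_finsetSum fun y _ ↦ contMDiffAt_const.mul (hφ y p)
      · exact contMDiffAt_finsetSum fun y _ ↦ hφ y p
      · exact (zero_lt_one.trans_le (hge p p (Metric.mem_ball_self hε))).ne'
    exact h1.congr_of_eventuallyEq
      (Filter.eventually_of_mem (Metric.ball_mem_nhds p hε) (hsum p))
  refine ⟨v, hsmooth, fun x t ht z hz ↦ ?_⟩
  have hball := Metric.isOpen_ball.mem_nhds hz
  have ha : ∀ y ∈ S x, |f y - f x| ≤ t := fun y hy ↦ ht y (by rw [hS] at hy; linarith)
  -- The weights sum to one, so `v - f x` is the weighted mean of the differences `f y - f x`. Thus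
  -- the gradient sees the oscillation of `f`, not its size.
  have hdiff : ∀ w ∈ Metric.ball (x : M) ε,
      v w - f x = (∑ y ∈ S x, (f y - f x) * φ y w) / ∑ y ∈ S x, φ y w := fun w hw ↦ by
    have h0 : ∑ y ∈ S x, φ y w ≠ 0 := (zero_lt_one.trans_le (hge x w hw)).ne'
    rw [hsum x w hw, eq_div_iff h0, sub_mul, div_mul_cancel₀ _ h0]
    simp only [sub_mul, Finset.sum_sub_distrib, Finset.mul_sum]
  constructor
  · have hpos : 0 < ∑ i ∈ S x, φ i z := zero_lt_one.trans_le (hge x z hz)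
    rw [hdiff z hz, abs_div, abs_of_pos hpos, div_le_iff₀ hpos, Finset.mul_sum]
    refine (Finset.abs_sum_le_sum_abs _ _).trans (Finset.sum_le_sum fun i hi ↦ ?_)
    rw [abs_mul, abs_of_nonneg (hφ0 i z)]
    exact mul_le_mul_of_nonneg_right (ha i hi) (hφ0 i z)
  · choose U hU hUlip using fun y : X ↦ hφlip y z
    set W := Metric.ball (x : M) ε ∩ ⋂ y ∈ S x, U y with hW
    have hWz : W ∈ 𝓝 z := Filter.inter_mem hball ((Filter.biInter_finset_mem _).2 fun y _ ↦ hU y)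
    have hlip := lipschitzOnWith_sum_div_sum (S := S x) (U := W) (φ := fun y : X ↦ φ y) (Λ := Λ)
      (fun y hy ↦ (hUlip y).mono (inter_subset_right.trans (biInter_subset_of_mem hy)))
      (fun y ↦ hφ0 y) (fun p hp ↦ hge x p hp.1) ha (hcard x)
    have hlip' : LipschitzOnWith (2 * N * Λ * t) v W := fun p hp q hq ↦ by
      have := hlip hp hq
      beta_reduce at this
      rw [← hdiff p hp.1, ← hdiff q hq.1, edist_sub_right] at this
      exact this
    refine (gradLength_le_of_lipschitzOnWith (hsmooth.mdifferentiableAt one_ne_zero) hWz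
      hlip').trans (le_of_eq ?_)
    push_cast
    ring

end

/-! ### From the inequality on the manifold to the discrete inequality -/

section DiscreteGradient

variable {V : Type*} {G : SimpleGraph V} {f : V → ℝ}

theorem enorm_sub_le_discreteGradLength {x y : V} (h : G.Adj x y) :
    ‖f y - f x‖ₑ ≤ discreteGradLength G f x := by
  have h1 : ‖f y - f x‖ₑ ^ 2 ≤ ∑' y : G.neighborSet x, ‖f y - f x‖ₑ ^ 2 :=
    ENNReal.le_tsum (f := fun y : G.neighborSet x ↦ ‖f y - f x‖ₑ ^ 2) ⟨y, h⟩
  calc ‖f y - f x‖ₑ = (‖f y - f x‖ₑ ^ 2) ^ (1 / 2 : ℝ) := by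
        rw [← ENNReal.rpow_natCast, ← ENNReal.rpow_mul]
        norm_num
    _ ≤ _ := ENNReal.rpow_le_rpow h1 (by norm_num)

theorem enorm_sub_le_of_walk {a : ℝ≥0∞} {x y : V} (w : G.Walk x y)
    (h : ∀ z ∈ w.support, discreteGradLength G f z ≤ a) : ‖f y - f x‖ₑ ≤ w.length * a := by
  induction w with
  | nil => simp
  | @cons x z y hadj w ih =>
    have h1 := ih fun z hz ↦ h z (List.mem_cons_of_mem _ hz)
    have h2 := (enorm_sub_le_discreteGradLength (f := f) hadj).trans (h x (by simp))
    rw [SimpleGraph.Walk.length_cons, ← sub_add_sub_cancel (f y) (f z) (f x)]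
    push_cast
    rw [add_mul, one_mul]
    exact (enorm_add_le _ _).trans (add_le_add h1 h2)

theorem discreteGradLength_ne_top {x : V} (h : (G.neighborSet x).Finite) :
    discreteGradLength G f x ≠ ⊤ := by
  refine ENNReal.rpow_ne_top_of_nonneg (by norm_num) ?_
  rw [tsum_coe_eq_sum_toFinset h fun y ↦ ‖f y - f x‖ₑ ^ 2]
  exact ENNReal.sum_ne_top.2 fun y _ ↦ ENNReal.pow_ne_top enorm_ne_top

end DiscreteGradient

section

variable {Y : Type*} [MetricSpace Y] {ε : ℝ} {X : Set Y} [MeasurableSpace Y] [BorelSpace Y]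
  {μ : Measure Y} [IsLocallyFiniteMeasure μ] [μ.IsOpenPosMeasure] {σ β : ℝ}

/-- Vertices within `4ε` are joined by walks of at most `k` edges, which stay within `2εk`.
Telescoping bounds the oscillation by `k` times the largest `δf` met, itself at most the `ℓ^σ` norm
over `T`; doubling makes the weights comparable. -/
theorem IsDiscretization.exists_oscillation_le (hX : IsDiscretization ε X) (hε : 0 < ε)
    (hD : LocalDoubling μ) (hconn : ∀ (p : Y) (r : ℝ), IsPreconnected (Metric.ball p r))
    (hσ : 0 < σ) : ∃ ρ : ℝ, 0 < ρ ∧ ∃ K : ℝ≥0∞, K ≠ ⊤ ∧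
      ∀ (f : X → ℝ) (x : X) (T : Finset X), (∀ z, z ∈ T ↔ dist (z : Y) x < ρ) → ∃ t : ℝ≥0,
        (∀ y : X, dist (y : Y) x < 4 * ε → |f y - f x| ≤ t) ∧
        (t : ℝ≥0∞) ^ σ * discretizationWeight μ ε X x ≤
          K * ∑ z ∈ T, discreteGradLength (discretizationGraph ε X) f z ^ σ *
            discretizationWeight μ ε X z := by
  obtain ⟨k, hk⟩ := hX.exists_edist_le hε hD hconn (4 * ε)
  obtain ⟨D, hDb⟩ := hD.exists_measure_ball_le hε (2 * ε * (k + 1) + ε)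
  obtain ⟨N, hN⟩ := hX.exists_finset hε hD (2 * ε)
  have hkσ : (k : ℝ≥0∞) ^ σ ≠ ⊤ := ENNReal.rpow_ne_top_of_nonneg hσ.le (by simp)
  refine ⟨2 * ε * (k + 1), by positivity, (k : ℝ≥0∞) ^ σ * D, by finiteness, fun f x T hT ↦ ?_⟩
  set G := discretizationGraph ε X
  have hδ : ∀ z, discreteGradLength G f z ≠ ⊤ := fun z ↦ by
    obtain ⟨S, hS, -⟩ := hN z
    refine discreteGradLength_ne_top (S.finite_toSet.subset fun y hy ↦ ?_)
    rw [Finset.mem_coe, hS, dist_comm]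
    exact hy.2
  set A := ∑ z ∈ T, discreteGradLength G f z ^ σ with hA
  have hAt : A ≠ ⊤ := ENNReal.sum_ne_top.2 fun z _ ↦ ENNReal.rpow_ne_top_of_nonneg hσ.le (hδ z)
  set t : ℝ≥0∞ := k * A ^ σ⁻¹ with ht
  have htt : t ≠ ⊤ :=
    ENNReal.mul_ne_top (by simp) (ENNReal.rpow_ne_top_of_nonneg (by positivity) hAt)
  refine ⟨t.toNNReal, fun y hy ↦ ?_, ?_⟩
  · have h1 := hk x x y (by rw [dist_self]; positivity) hy
    obtain ⟨w, hw⟩ := SimpleGraph.exists_walk_of_edist_ne_top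
      (ne_top_of_le_ne_top (ENat.natCast_ne_top k) h1)
    rw [← hw] at h1
    have hlen : w.length ≤ k := by exact_mod_cast h1
    have h2 : ‖f y - f x‖ₑ ≤ t := by
      refine (enorm_sub_le_of_walk w (a := A ^ σ⁻¹) fun z hz ↦ ?_).trans
        (mul_le_mul' (by exact_mod_cast hlen) le_rfl)
      rw [ENNReal.le_rpow_inv_iff hσ]
      refine Finset.single_le_sum (f := fun z ↦ discreteGradLength G f z ^ σ) (fun _ _ ↦ zero_le) ?_
      classical
      rw [hT, dist_comm]
      refine (dist_le_of_walk (w.takeUntil z hz)).trans_lt ?_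
      have h3 : ((w.takeUntil z hz).length : ℝ) ≤ k := by
        exact_mod_cast (w.length_takeUntil_le_length hz).trans hlen
      gcongr
      linarith
    rw [Real.enorm_eq_ofReal_abs, ENNReal.ofReal_le_iff_le_toReal htt] at h2
    exact h2
  · rw [ENNReal.coe_toNNReal htt, ht, ENNReal.mul_rpow_of_nonneg _ _ hσ.le,
      ENNReal.rpow_inv_rpow hσ.ne', mul_assoc, mul_assoc]
    refine mul_le_mul' le_rfl ?_
    rw [hA, Finset.sum_mul, Finset.mul_sum]
    refine Finset.sum_le_sum fun z hz ↦ ?_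
    rw [mul_left_comm]
    refine mul_le_mul' le_rfl ((measure_mono (Metric.ball_subset_ball' ?_)).trans (hDb z))
    rw [dist_comm, add_comm]
    linarith [(hT z).1 hz]

end

section

variable {n : ℕ} {M : Type*} [MetricSpace M] [MeasurableSpace M] [BorelSpace M]
  [ChartedSpace (EuclideanSpace ℝ (Fin n)) M] [IsManifold (𝓡 n) ∞ M]
  [RiemannianBundle (fun x : M ↦ TangentSpace (𝓡 n) x)]
  [IsContinuousRiemannianBundle (EuclideanSpace ℝ (Fin n))
  (fun x : M ↦ TangentSpace (𝓡 n) x)]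
  [IsRiemannianManifold (𝓡 n) M] [ProperSpace M] {σ β ε : ℝ}

/-- Apply the manifold inequality to the smoothing `v` of `f`. Both `v - f x` and `|∇v|` on `B(x,
ε)` are governed by the local oscillation `t x`, whose weighted `σ`-th powers sum to a multiple of
the discrete energy. -/
theorem IsDiscretization.discretePoincare_of_uniformPoincare {X : Set M} (hX : IsDiscretization ε X)
    (hε : 0 < ε) (hD : LocalDoubling (riemannianVolume n M)) (hσ : 1 ≤ σ) (hβ : 0 ≤ β)
    (hU : UniformPoincare n M σ β) : DiscretePoincare (discretizationGraph ε X)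
      (discretizationWeight (riemannianVolume n M) ε X) σ β := by
  set μ := riemannianVolume n M with hμ
  have hσ0 : 0 < σ := by linarith
  have hconn := isPreconnected_ball (M := M) n
  obtain ⟨C, hC, hU⟩ := hU
  obtain ⟨K, hK, hU⟩ := hU ε hε
  obtain ⟨Λ, hΛ⟩ := hX.exists_smoothing n hε hD
  obtain ⟨ρ, hρ, K₁, hK₁, hosc⟩ := hX.exists_oscillation_le hε hD hconn hσ0
  obtain ⟨a, b, ha, hb, hab⟩ := hX.exists_mem_graphBall hε hD hconn (exists_dist_lt_dist_lt n)
  obtain ⟨N₁, hN₁⟩ := hX.exists_sum_sum_le hε hD ρ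
  obtain ⟨N₂, hN₂⟩ := hX.exists_sum_lintegral_le hε hD ε
  obtain ⟨_, hfinset⟩ := hX.exists_finset hε hD ρ
  choose T hT _ using hfinset
  have h2 : (2 : ℝ≥0∞) ^ (σ - 1) ≠ ⊤ := ENNReal.rpow_ne_top_of_nonneg (by linarith) (by simp)
  have hΛσ : (Λ : ℝ≥0∞) ^ σ ≠ ⊤ := ENNReal.rpow_ne_top_of_nonneg hσ0.le (by simp)
  set Q : ℝ≥0∞ := 2 ^ (σ - 1) * 2 * (2 ^ (σ - 1) * (K₁ * N₁ +
    N₂ * ENNReal.ofReal (K * (3 * ε) ^ β) * (Λ ^ σ * (K₁ * N₁)))) with hQ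
  have hQt : Q ≠ ⊤ := by rw [hQ]; finiteness
  -- `D₁ R` bounds the distance from `x₀` to every vertex where `δf` is evaluated, given `ϱ ≤ 3εR`.
  set D₁ := 3 * C * ε + 3 * ε + ρ with hD₁
  have hD₁0 : 0 < D₁ := by positivity
  -- For `R ≥ 1`, metric distance `D₁ R` means graph radius `a D₁ R + b ≤ (a D₁ + b) R`; the extra 1
  -- ensures `C' ≥ 1`.
  refine ⟨1, one_pos, Q.toReal + 1, by positivity, a * D₁ + b + 1, by nlinarith [mul_pos ha hD₁0],
    fun f R hR x₀ ↦ ?_⟩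
  set G := discretizationGraph ε X
  set W := discretizationWeight μ ε X with hW
  have hWt : ∀ x, W x ≠ ⊤ := fun x ↦ (hD.measure_ball_lt_top _ _).ne
  have hR0 : 0 < R := by linarith
  have hfin := hX.finite_graphBall hε hD x₀ R
  have hfin' := hX.finite_graphBall hε hD x₀ ((a * D₁ + b + 1) * R)
  set S := hfin.toFinset with hS
  set S' := hfin'.toFinset with hS'
  -- The ball of radius `ϱ` around `x₀` contains `B(x, ε)` for every vertex `x` of the graph ball of
  -- radius `R`, and `ϱ ≥ ε`, the threshold at which `hU` was taken.
  set ϱ := 2 * ε * R + ε with hϱ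
  have hϱε : ε ≤ ϱ := by rw [hϱ]; nlinarith
  have hϱR : ϱ ≤ 3 * ε * R := by rw [hϱ]; nlinarith
  have hϱ0 : 0 < ϱ := hε.trans_le hϱε
  have hDR : C * ϱ + ε + 2 * ε * R + ρ ≤ D₁ * R := by
    have e1 : C * ϱ ≤ C * (3 * ε * R) := by gcongr
    rw [hD₁]
    nlinarith
  have hmem : ∀ z : X, dist (x₀ : M) z < D₁ * R → z ∈ S' := fun z hz ↦ by
    rw [hS', hfin'.mem_toFinset]
    refine lt_of_lt_of_le (hab x₀ z _ (by positivity) hz) (ENNReal.ofReal_le_ofReal ?_)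
    nlinarith
  obtain ⟨v, hv, hvx⟩ := hΛ f
  choose t ht htσ using fun x ↦ hosc f x (T x) (hT x)
  set c := ⨍ y in Metric.ball (x₀ : M) ϱ, v y ∂μ with hc
  rw [tsum_coe_eq_sum_toFinset hfin' (fun x ↦ discreteGradLength G f x ^ σ * W x)]
  refine (tsum_enorm_sub_weightedMean_le hσ hfin hWt c).trans ?_
  rw [tsum_coe_eq_sum_toFinset hfin (fun x ↦ ‖f x - c‖ₑ ^ σ * W x)]
  set I := ∑ x ∈ S', discreteGradLength G f x ^ σ * W x with hI
  have hsumt : ∀ F : Finset X, (∀ x ∈ F, dist (x₀ : M) x < C * ϱ + ε + 2 * ε * R) →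
      ∑ x ∈ F, (t x : ℝ≥0∞) ^ σ * W x ≤ K₁ * (N₁ * I) := fun F hF ↦ by
    refine (Finset.sum_le_sum fun x _ ↦ htσ x).trans ?_
    rw [← Finset.mul_sum]
    refine mul_le_mul' le_rfl (hN₁ F S' (fun x ↦ T x) (fun x hx z hz ↦ ?_) _)
    have h1 := (hT x z).1 hz
    refine ⟨hmem z ?_, h1⟩
    have h2 := dist_triangle (x₀ : M) x z
    rw [dist_comm (x : M) z] at h2
    linarith [hF x hx]
  have hSx : ∀ x ∈ S, dist (x₀ : M) x < 2 * ε * R := fun x hx ↦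
    dist_lt_of_mem_graphBall hε (hfin.mem_toFinset.1 hx)
  have hball : ∀ x : X, ‖f x - c‖ₑ ^ σ * W x ≤
      2 ^ (σ - 1) * ((t x : ℝ≥0∞) ^ σ * W x +
        ∫⁻ y in Metric.ball (x : M) ε, ‖v y - c‖ₑ ^ σ ∂μ) := fun x ↦ by
    calc ‖f x - c‖ₑ ^ σ * W x = ∫⁻ y in Metric.ball (x : M) ε, ‖f x - c‖ₑ ^ σ ∂μ := by
          rw [setLIntegral_const]; rfl
      _ ≤ ∫⁻ y in Metric.ball (x : M) ε, 2 ^ (σ - 1) * ((t x : ℝ≥0∞) ^ σ + ‖v y - c‖ₑ ^ σ) ∂μ := by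
          refine setLIntegral_mono_ae' measurableSet_ball
            (Filter.Eventually.of_forall fun y hy ↦ ?_)
          refine (enorm_sub_rpow_le hσ (f x) (v y) c).trans
            (mul_le_mul' le_rfl (add_le_add (ENNReal.rpow_le_rpow ?_ hσ0.le) le_rfl))
          rw [enorm_sub_rev, Real.enorm_eq_ofReal_abs, ← ENNReal.ofReal_coe_nnreal]
          exact ENNReal.ofReal_le_ofReal (hvx x (t x) (ht x) y hy).1
      _ = _ := by
          rw [lintegral_const_mul' _ _ h2, lintegral_add_left measurable_const, setLIntegral_const]
          rfl
  have hgrad : ∫⁻ y in Metric.ball (x₀ : M) (C * ϱ), gradLength n v y ^ σ ∂μ ≤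
      Λ ^ σ * (K₁ * (N₁ * I)) := by
    obtain ⟨_, hF⟩ := hX.exists_finset hε hD (C * ϱ + ε)
    obtain ⟨F, hF, -⟩ := hF x₀
    have hcov : Metric.ball (x₀ : M) (C * ϱ) ⊆ ⋃ x ∈ F, Metric.ball (x : M) ε := fun y hy ↦ by
      obtain ⟨x, hx⟩ := hX.exists_dist_lt hε y
      refine mem_iUnion₂.2 ⟨x, ?_, hx⟩
      rw [Metric.mem_ball] at hy
      rw [hF]
      linarith [dist_triangle_left (x : M) x₀ y]
    calc _ ≤ ∑ x ∈ F, ∫⁻ y in Metric.ball (x : M) ε, gradLength n v y ^ σ ∂μ :=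
          setLIntegral_le_sum_of_subset hcov _
      _ ≤ ∑ x ∈ F, (Λ : ℝ≥0∞) ^ σ * ((t x : ℝ≥0∞) ^ σ * W x) := Finset.sum_le_sum fun x _ ↦ by
          calc _ ≤ ∫⁻ y in Metric.ball (x : M) ε, ((Λ : ℝ≥0∞) * t x) ^ σ ∂μ :=
                setLIntegral_mono_ae' measurableSet_ball (Filter.Eventually.of_forall fun y hy ↦
                  ENNReal.rpow_le_rpow (hvx x (t x) (ht x) y hy).2 hσ0.le)
            _ = _ := by
                rw [setLIntegral_const, ENNReal.mul_rpow_of_nonneg _ _ hσ0.le, mul_assoc]; rfl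
      _ ≤ _ := by
          rw [← Finset.mul_sum]
          refine mul_le_mul' le_rfl (hsumt F fun x hx ↦ ?_)
          rw [hF, dist_comm] at hx
          have : 0 < 2 * ε * R := by positivity
          linarith
  have hv' : ∑ x ∈ S, ∫⁻ y in Metric.ball (x : M) ε, ‖v y - c‖ₑ ^ σ ∂μ ≤
      N₂ * (ENNReal.ofReal (K * (3 * ε) ^ β) * ENNReal.ofReal (R ^ β) *
        (Λ ^ σ * (K₁ * (N₁ * I)))) := by
    refine (hN₂ S (Metric.ball (x₀ : M) ϱ) measurableSet_ball (fun x hx ↦ ?_) _).trans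
      (mul_le_mul' le_rfl ((hU v hv ϱ hϱε x₀).trans (mul_le_mul' ?_ hgrad)))
    · refine Metric.ball_subset_ball' ?_
      rw [dist_comm]
      linarith [hSx x hx]
    · rw [← ENNReal.ofReal_mul (by positivity), mul_assoc,
        ← Real.mul_rpow (by positivity) hR0.le]
      exact ENNReal.ofReal_le_ofReal (by gcongr)
  have hRβ : (1 : ℝ≥0∞) ≤ ENNReal.ofReal (R ^ β) :=
    ENNReal.one_le_ofReal.2 (Real.one_le_rpow hR hβ)
  calc _ ≤ 2 ^ (σ - 1) * 2 * ∑ x ∈ S, 2 ^ (σ - 1) * ((t x : ℝ≥0∞) ^ σ * W x +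
        ∫⁻ y in Metric.ball (x : M) ε, ‖v y - c‖ₑ ^ σ ∂μ) :=
        mul_le_mul' le_rfl (Finset.sum_le_sum fun x _ ↦ hball x)
    _ ≤ 2 ^ (σ - 1) * 2 * (2 ^ (σ - 1) * (K₁ * (N₁ * I) * ENNReal.ofReal (R ^ β) +
        N₂ * (ENNReal.ofReal (K * (3 * ε) ^ β) * ENNReal.ofReal (R ^ β) *
        (Λ ^ σ * (K₁ * (N₁ * I)))))) := by
        rw [← Finset.mul_sum, Finset.sum_add_distrib]
        refine mul_le_mul' le_rfl (mul_le_mul' le_rfl (add_le_add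
          ((hsumt S fun x hx ↦ ?_).trans (le_mul_of_one_le_right' hRβ)) hv'))
        have : 0 < C * ϱ := by positivity
        linarith [hSx x hx]
    _ = Q * ENNReal.ofReal (R ^ β) * I := by rw [hQ]; ring
    _ ≤ _ := mul_le_mul' (ENNReal.le_ofReal_mul_of_le_mul hQt le_rfl) le_rfl

end

theorem theorem3p1 (n : ℕ) (M : Type*) [MetricSpace M] [CompleteSpace M]
    [MeasurableSpace M] [BorelSpace M]
    [ChartedSpace (EuclideanSpace ℝ (Fin n)) M] [IsManifold (𝓡 n) ∞ M]
    [RiemannianBundle (fun x : M ↦ TangentSpace (𝓡 n) x)]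
    [IsContMDiffRiemannianBundle (𝓡 n) ∞ (EuclideanSpace ℝ (Fin n))
      (fun x : M ↦ TangentSpace (𝓡 n) x)]
    [IsRiemannianManifold (𝓡 n) M]
    (σ β : ℝ) (hσ : 1 ≤ σ) (hβ : 1 ≤ β)
    (hDV : LocalDoubling (riemannianVolume n M)) (hP : LocalPoincare n M σ)
    (ε : ℝ) (hε : 0 < ε) (X : Set M) (hX : IsDiscretization ε X) :
    UniformPoincare n M σ β ↔
      DiscretePoincare (discretizationGraph ε X)
        (discretizationWeight (riemannianVolume n M) ε X) σ β := by
  -- The only place where completeness enters.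
  have hproper : ProperSpace M := hDV.properSpace
  exact ⟨fun h ↦ hX.discretePoincare_of_uniformPoincare hε hDV hσ (by linarith) h,
    fun h ↦ hX.uniformPoincare_of_discretePoincare hε hDV hP hσ (by linarith) h⟩
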